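/- Consider the Hegselmann--Krause dynamics with confidence bound $1$: agents $i$ with opinions $x_t(i)\in\mathbb{R}$, $t=0,1,2,\dots$, updated by $$x_{t+1}(i)=\frac{1}{|\mathcal N_t(i)|}\sum_{j\in\mathcal N_t(i)}x_t(j),\qquad \mathcal N_t(i)=\{j:|x_t(j)-x_t(i)|\le 1\}.$$ The receptivity graph $G_t$ joins distinct agents $i,j$ when $|x_t(i)-x_t(j)|\le 1$; a cluster is a maximal nonempty set of agents with equal opinions; a configuration is frozen if any two different opinions are more than $1$ apart. Let $\mathcal E_{\infty,d}=(1,1+d,1+2d,\dots)$ and $\mathcal E_{n,d}=(1,1+d,\dots,1+(n-1)d)$, and let $d_3=\frac{31104}{36979}$, $d_4=\frac45$. There is a nonempty open interval $I\subseteq(d_4,d_3]$ such that the following holds for every $d\in I$. (i) Started from $\mathcal E_{\infty,d}$, the evolution is periodic: all the sets $\mathcal N_t(i)$ are finite; $\{i+4,i'+4\}$ is an edge of $G_{t+8}$ if and only if $\{i,i'\}$ is an edge of $G_t$; and for every $j\ge 0$ the agents $i\ge 4j+1$ form one connected component of $G_t$ for $8j\le t<8(j+1)$, while the four agents $4j+1,\dots,4j+4$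 form a component of $G_t$ for all $t\ge 8(j+1)$, are not a cluster at time $8(j+1)$, and are a cluster at all times $t\ge 8(j+1)+1$. (ii) There are positive constants $C,C'$ such that for every $n$ there is $k$ with $0\le n-8k\le C$ for which the configuration started from $\mathcal E_{n,d}$ evolves as follows. For every $0\le j<k$ the agents $4j+1,\dots,n-4j$ form one component of $G_t$ for $8j\le t<8(j+1)$, and each of the groups $\{4j+1,\dots,4j+4\}$ and $\{n-4j-3,\dots,n-4j\}$ is a component of $G_t$ for all $t\ge 8(j+1)$, is not a cluster at time $8(j+1)$, and is a cluster at all times $t\ge 8(j+1)+1$. The $n-8k\le C$ agents left in the middle (if any) form one component at time $8k$. At all times $t\ge 8k+C'$ the whole configuration is frozen, and the agents left in the middle form a single cluster, except that if exactly six agents are left they form two clusters of three. Moreover, there is a constant $K$, independent of $n$, such that the freezing time $T(n)$, i.e. the first time at which the configuration is frozen, satisfies $|T(n)-n|\le K$ for all $n$. -/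

import Mathlib

/-! The one-dimensional Hegselmann-Krause dynamics with confidence bound `1`, for a finite or
infinite family of agents. Agents are numbered from `0`. -/

namespace HK

/-- The agents whose opinion is within distance `1` of the opinion of agent `i`. -/
def nbhd {ι : Type*} (x : ι → ℝ) (i : ι) : Set ι := {j | |x j - x i| ≤ 1}

/-- One synchronous update: every agent moves to the mean opinion of its neighbourhood. -/
noncomputable def step {ι : Type*} (x : ι → ℝ) : ι → ℝ :=
  fun i => (∑ᶠ j ∈ nbhd x i, x j) / ((nbhd x i).ncard : ℝ)

/-- The opinions at time `t` when the opinions at time `0` are `x₀`. -/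
noncomputable def evolve {ι : Type*} (x₀ : ι → ℝ) (t : ℕ) : ι → ℝ := step^[t] x₀

/-- The receptivity graph: distinct agents are adjacent when their opinions differ by at most `1`. -/
def receptivityGraph {ι : Type*} (x : ι → ℝ) : SimpleGraph ι where
  Adj i j := i ≠ j ∧ |x i - x j| ≤ 1
  symm := ⟨fun i j h => ⟨h.1.symm, by rw [abs_sub_comm]; exact h.2⟩⟩
  loopless := ⟨fun _ h => h.1 rfl⟩

/-- The set `S` of agents is a connected component of the receptivity graph. -/
def IsComponent {ι : Type*} (x : ι → ℝ) (S : Set ι) : Prop :=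
  ∃ c : (receptivityGraph x).ConnectedComponent, c.supp = S

/-- The set `S` of agents is a cluster: a (nonempty) maximal set of agents with the same opinion. -/
def IsCluster {ι : Type*} (x : ι → ℝ) (S : Set ι) : Prop :=
  ∃ i, S = {j | x j = x i}

/-- The configuration is frozen: different opinions are more than `1` apart. -/
def Frozen {ι : Type*} (x : ι → ℝ) : Prop :=
  ∀ i j, x i ≠ x j → 1 < |x i - x j|

/-- The infinite equally spaced configuration `1, 1 + d, 1 + 2d, …`. -/
def equalInf (d : ℝ) : ℕ → ℝ := fun i => 1 + (i : ℝ) * d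

/-- The equally spaced configuration `1, 1 + d, …, 1 + (n - 1) d` of `n` agents. -/
def equalFin (n : ℕ) (d : ℝ) : Fin n → ℝ := fun i => 1 + ((i : ℕ) : ℝ) * d

/-- The `j`-th group of four agents, counted from the left, in the infinite system. -/
def groupInf (j : ℕ) : Set ℕ := {i | 4 * j ≤ i ∧ i < 4 * (j + 1)}

/-- All agents of the infinite system but the first `j` groups of four. -/
def restInf (j : ℕ) : Set ℕ := {i | 4 * j ≤ i}

/-- The `j`-th group of four agents, counted from the left end, among `n` agents. -/
def leftGroup (n j : ℕ) : Set (Fin n) := {i | 4 * j ≤ (i : ℕ) ∧ (i : ℕ) < 4 * (j + 1)}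

/-- The `j`-th group of four agents, counted from the right end, among `n` agents. -/
def rightGroup (n j : ℕ) : Set (Fin n) := {i | n ≤ (i : ℕ) + 4 * (j + 1) ∧ (i : ℕ) + 4 * j < n}

/-- The agents left in the middle when `j` groups of four are removed at each end. -/
def middle (n j : ℕ) : Set (Fin n) := {i | 4 * j ≤ (i : ℕ) ∧ (i : ℕ) + 4 * j < n}

/-- The group `S` of agents is a connected component of the receptivity graph at time `s` and
at all later times, and it collapses to a cluster exactly one step after time `s`. -/
def DetachesAt {ι : Type*} (x : ℕ → ι → ℝ) (S : Set ι) (s : ℕ) : Prop :=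
  (∀ t, s ≤ t → IsComponent (x t) S) ∧
  ¬ IsCluster (x s) S ∧ ∀ t, s + 1 ≤ t → IsCluster (x t) S

/-- Periodic evolution of an infinite system of agents: for every `j`, the agents from `4 * j` on
form one component during the times `8 * j, …, 8 * j + 7`, and at time `8 * (j + 1)` the next four
agents become disconnected on the left, collapsing to a cluster one step later.
Moreover all updates are means over finite sets, and eight steps shift the receptivity graph by
four agents. -/
def PeriodicInf (x : ℕ → ℕ → ℝ) : Prop :=
  (∀ t i, (nbhd (x t) i).Finite) ∧
  (∀ j t, 8 * j ≤ t → t < 8 * (j + 1) → IsComponent (x t) (restInf j)) ∧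
  (∀ j, DetachesAt x (groupInf j) (8 * (j + 1))) ∧
  (∀ t i i', (receptivityGraph (x (t + 8))).Adj (i + 4) (i' + 4) ↔
    (receptivityGraph (x t)).Adj i i')

/-- The analogous evolution of `n` agents during `k` periods of eight steps: in the `j`-th period
the agents not yet detached form one component, and at its end four of them become disconnected at
either end, collapsing to clusters one step later; after the `k` periods the agents left in the
middle (if any) form one component. -/
def PeriodicFin {n : ℕ} (x : ℕ → Fin n → ℝ) (k : ℕ) : Prop :=
  8 * k ≤ n ∧
  (∀ j, j < k → ∀ t, 8 * j ≤ t → t < 8 * (j + 1) → IsComponent (x t) (middle n j)) ∧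
  (∀ j, j < k → DetachesAt x (leftGroup n j) (8 * (j + 1)) ∧
    DetachesAt x (rightGroup n j) (8 * (j + 1))) ∧
  (8 * k < n → IsComponent (x (8 * k)) (middle n k))

/-- The `n - 8 * k` agents left in the middle have collapsed: to one cluster if their number is
neither `0` nor `6`, and to two clusters of three if their number is `6`. -/
def MiddleCollapsed {n : ℕ} (x : Fin n → ℝ) (k : ℕ) : Prop :=
  (8 * k < n → n ≠ 8 * k + 6 → IsCluster x (middle n k)) ∧
  (n = 8 * k + 6 →
    IsCluster x {i | 4 * k ≤ (i : ℕ) ∧ (i : ℕ) < 4 * k + 3} ∧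
    IsCluster x {i | 4 * k + 3 ≤ (i : ℕ) ∧ (i : ℕ) < 4 * k + 6})

end HK

/-!
The configuration is divided by `d`, so that the initial gaps are `1` and the confidence bound is
`θ = 1 / d`; for `d` between `100 / 123` and `50 / 61` one has `61 / 50 < θ < 123 / 100`. The agents are
sorted, and a step replaces each opinion by the mean over an interval of agents, the window. The
mean of a monotone function increases when the window is shifted to the right
(`windowMean_mono`). Applied to differences of configurations, this is a comparison principle
(`Encloses.step`): if all gaps lie between those of a lower and of an upper configuration, and these
two bounds already determine the neighbourhoods, then the gaps after one step lie between those of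
the averages of the two bounding configurations. Hence a finite computation with integers controls
all configurations in a box of gaps at once.

The box used is `Balanced m`: the gaps of the `m` agents equal `1` up to
`2 ^ (-6 - min i (m - 2 - i))`. Within eight steps four agents detach at each end, and the gaps of
the remaining `m - 8` agents satisfy `Balanced (m - 8)` (`periodOK`). For `m < 44` this is checked by
kernel computation (`periodOK_of_lt`). For larger `m` only the gaps near the ends are computed; in
the interior a step averages three consecutive gaps, so that a deviation of size `2 ^ (-i)` grows by
the factor `7 / 6` per step. Over a period this amounts to less than `4`, while the move of the end by
four agents gains `16` (`HalfStart.interior`, `HalfStart.head_eight`, `periodOK_of_ge`). The same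
argument with one end covers the infinite system.

A gap larger than `θ` persists (`IsEvolution.gap_of_le`), so that the agents left after a period form
an evolution of their own (`IsEvolution.block`), and induction over the periods applies
(`middle_evolution`, `rest_evolution`). The at most seven agents left in the end collapse within
eleven steps by another computation (`final_collapse`). A detached group collapses in one step
because any two of its agents are neighbours. Since no configuration before the end of the last
period is frozen (`le_of_frozen`), the freezing time differs from `n` by at most `11`.
-/

namespace HK

/-! ### Means over windows of agents -/

/-- The mean of `x` over the agents `a, …, b`. -/
noncomputable def windowMean (x : ℕ → ℝ) (a b : ℕ) : ℝ :=
  (∑ k ∈ Finset.Icc a b, x k) / ((b : ℝ) + 1 - a)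

lemma le_windowMean {x : ℕ → ℝ} {a b : ℕ} {c : ℝ} (hab : a ≤ b)
    (h : ∀ k, a ≤ k → k ≤ b → c ≤ x k) : c ≤ windowMean x a b := by
  have hab' : (a : ℝ) ≤ b := by exact_mod_cast hab
  rw [windowMean, le_div_iff₀ (by linarith)]
  have h1 := Finset.card_nsmul_le_sum (Finset.Icc a b) x c fun k hk =>
    h k (Finset.mem_Icc.1 hk).1 (Finset.mem_Icc.1 hk).2
  rw [Nat.card_Icc, nsmul_eq_mul, Nat.cast_sub (by omega)] at h1
  push_cast at h1
  linarith

lemma windowMean_neg (x : ℕ → ℝ) (a b : ℕ) :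
    windowMean (fun k => -x k) a b = -windowMean x a b := by
  simp [windowMean, Finset.sum_neg_distrib, neg_div]

lemma windowMean_le {x : ℕ → ℝ} {a b : ℕ} {c : ℝ} (hab : a ≤ b)
    (h : ∀ k, a ≤ k → k ≤ b → x k ≤ c) : windowMean x a b ≤ c := by
  have := le_windowMean (x := fun k => -x k) (c := -c) hab fun k h1 h2 => neg_le_neg (h k h1 h2)
  rw [windowMean_neg] at this
  linarith

lemma windowMean_mono_right {z : ℕ → ℝ} {a b b' : ℕ} (hab : a ≤ b) (hb : b ≤ b')
    (hz : ∀ i j, i ≤ j → j ≤ b' → z i ≤ z j) : windowMean z a b ≤ windowMean z a b' := by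
  induction b', hb using Nat.le_induction with
  | base => exact le_rfl
  | succ n hn ih =>
    refine (ih fun i j h1 h2 => hz i j h1 (by omega)).trans ?_
    have h1 : windowMean z a n ≤ z (n + 1) :=
      windowMean_le (by omega) fun k _ hk => hz _ _ (by omega) le_rfl
    have han : (a : ℝ) ≤ n := by exact_mod_cast hab.trans hn
    rw [windowMean, div_le_iff₀ (by linarith)] at h1
    rw [windowMean, windowMean, Finset.sum_Icc_succ_top (by omega),
      div_le_div_iff₀ (by linarith) (by push_cast; linarith)]
    push_cast
    nlinarith

lemma windowMean_mono_left {z : ℕ → ℝ} {a a' b : ℕ} (ha : a ≤ a') (hab : a' ≤ b)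
    (hz : ∀ i j, i ≤ j → j ≤ b → z i ≤ z j) : windowMean z a b ≤ windowMean z a' b := by
  induction a', ha using Nat.le_induction with
  | base => exact le_rfl
  | succ n hn ih =>
    refine (ih (by omega)).trans ?_
    have h1 : z n ≤ windowMean z (n + 1) b :=
      le_windowMean hab fun k hk hk' => hz _ _ (by omega) hk'
    have hnb : (n : ℝ) + 1 ≤ b := by exact_mod_cast hab
    rw [windowMean, le_div_iff₀ (by push_cast; linarith)] at h1
    have h2 : ∑ k ∈ Finset.Icc n b, z k = z n + ∑ k ∈ Finset.Icc (n + 1) b, z k := by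
      rw [← Finset.insert_Icc_add_one_left_eq_Icc (by omega : n ≤ b), Finset.sum_insert (by simp)]
    rw [windowMean, windowMean, h2, div_le_div_iff₀ (by linarith) (by push_cast; linarith)]
    push_cast at h1 ⊢
    nlinarith

/-- Shifting a window to the right increases the mean of a monotone function. -/
lemma windowMean_mono {z : ℕ → ℝ} {a b a' b' : ℕ} (hab : a ≤ b) (hab' : a' ≤ b') (ha : a ≤ a')
    (hb : b ≤ b') (hz : ∀ i j, i ≤ j → j ≤ b' → z i ≤ z j) :
    windowMean z a b ≤ windowMean z a' b' :=
  (windowMean_mono_right hab hb hz).trans (windowMean_mono_left ha hab' hz)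

lemma windowMean_shift (x : ℕ → ℝ) (s a b : ℕ) :
    windowMean (fun k => x (s + k)) a b = windowMean x (s + a) (s + b) := by
  unfold windowMean
  congr 1
  · rw [← Finset.map_add_left_Icc, Finset.sum_map]
    rfl
  · push_cast
    ring

lemma windowMean_reflect (x : ℕ → ℝ) {m a b : ℕ} (hab : a ≤ b) (hb : b < m) :
    windowMean (fun k => x (m - 1 - k)) a b = windowMean x (m - 1 - b) (m - 1 - a) := by
  unfold windowMean
  congr 1
  · refine Finset.sum_nbij' (fun k => m - 1 - k) (fun k => m - 1 - k) ?_ ?_ ?_ ?_ ?_ <;>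
      intro k hk <;> simp only [Finset.mem_Icc] at * <;> omega
  · rw [Nat.sub_sub, Nat.sub_sub, Nat.cast_sub (by omega), Nat.cast_sub (by omega)]
    push_cast
    ring

/-! ### Abstract evolutions on the line -/

/-- Among the agents in `S` with opinions `x`, those within distance `θ` of agent `i` are exactly
the agents `a, …, b`. -/
structure IsWindow (θ : ℝ) (S : Set ℕ) (x : ℕ → ℝ) (i a b : ℕ) : Prop where
  left_le : a ≤ i
  le_right : i ≤ b
  right_mem : b ∈ S
  near_iff : ∀ j ∈ S, |x j - x i| ≤ θ ↔ a ≤ j ∧ j ≤ b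

/-- `X` is a Hegselmann-Krause evolution with confidence bound `θ` of the agents in `S`, where `S`
is an initial segment of `ℕ`. The agents are numbered in the order of their opinions, and each has
finitely many neighbours. Values of `X` outside `S` are irrelevant. -/
structure IsEvolution (θ : ℝ) (S : Set ℕ) (X : ℕ → ℕ → ℝ) : Prop where
  lower : ∀ i j, i ≤ j → j ∈ S → i ∈ S
  mono : ∀ t i j, i ≤ j → j ∈ S → X t i ≤ X t j
  exists_window : ∀ t, ∀ i ∈ S, ∃ a b, IsWindow θ S (X t) i a b
  update : ∀ t, ∀ i ∈ S, ∀ a b, IsWindow θ S (X t) i a b → X (t + 1) i = windowMean (X t) a b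

section Window

variable {θ : ℝ} {S : Set ℕ} {x : ℕ → ℝ}

lemma IsWindow.unique {i a b a' b' : ℕ} (hS : ∀ i j, i ≤ j → j ∈ S → i ∈ S)
    (h : IsWindow θ S x i a b) (h' : IsWindow θ S x i a' b') : a = a' ∧ b = b' := by
  have ha := hS _ _ (h.left_le.trans h.le_right) h.right_mem
  have ha' := hS _ _ (h'.left_le.trans h'.le_right) h'.right_mem
  have h1 := (h'.near_iff a ha).1 ((h.near_iff a ha).2 ⟨le_rfl, h.left_le.trans h.le_right⟩)
  have h2 := (h.near_iff a' ha').1 ((h'.near_iff a' ha').2 ⟨le_rfl, h'.left_le.trans h'.le_right⟩)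
  have h3 := (h'.near_iff b h.right_mem).1
    ((h.near_iff b h.right_mem).2 ⟨h.left_le.trans h.le_right, le_rfl⟩)
  have h4 := (h.near_iff b' h'.right_mem).1
    ((h'.near_iff b' h'.right_mem).2 ⟨h'.left_le.trans h'.le_right, le_rfl⟩)
  omega

/-- For monotone opinions, a window can be recognised at its two ends. -/
lemma isWindow_of_mono (hS : ∀ i j, i ≤ j → j ∈ S → i ∈ S)
    (hx : ∀ i j, i ≤ j → j ∈ S → x i ≤ x j) {i a b : ℕ} (ha : a ≤ i) (hb : i ≤ b) (hbS : b ∈ S)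
    (ha1 : x i - x a ≤ θ) (hb1 : x b - x i ≤ θ) (ha2 : ∀ c, c + 1 = a → θ < x i - x c)
    (hb2 : b + 1 ∈ S → θ < x (b + 1) - x i) : IsWindow θ S x i a b where
  left_le := ha
  le_right := hb
  right_mem := hbS
  near_iff := by
    intro j hj
    have hi : i ∈ S := hS _ _ hb hbS
    constructor
    · intro h
      rw [abs_le] at h
      constructor
      · by_contra hlt
        have h1 := ha2 (a - 1) (by omega)
        have h2 := hx j (a - 1) (by omega) (hS _ _ (by omega) hi)
        linarith
      · by_contra hlt
        have h1 := hb2 (hS _ _ (by omega) hj)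
        have h2 := hx (b + 1) j (by omega) hj
        linarith
    · rintro ⟨h1, h2⟩
      have h3 := hx a j h1 hj
      have h4 := hx j b h2 hbS
      rw [abs_le]
      constructor <;> linarith

lemma exists_window_of_finite (hS : ∀ i j, i ≤ j → j ∈ S → i ∈ S)
    (hx : ∀ i j, i ≤ j → j ∈ S → x i ≤ x j) (hθ : 0 ≤ θ) {i : ℕ} (hi : i ∈ S)
    (hfin : {j | j ∈ S ∧ |x j - x i| ≤ θ}.Finite) : ∃ a b, IsWindow θ S x i a b := by
  have hmem : i ∈ hfin.toFinset := by simpa using ⟨hi, hθ⟩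
  have key : ∀ j, j ∈ hfin.toFinset ↔ j ∈ S ∧ |x j - x i| ≤ θ := fun j => by simp
  set F := hfin.toFinset
  have hne : F.Nonempty := ⟨i, hmem⟩
  have ha := (key _).1 (F.min'_mem hne)
  have hb := (key _).1 (F.max'_mem hne)
  refine ⟨F.min' hne, F.max' hne, isWindow_of_mono hS hx (F.min'_le _ hmem) (F.le_max' _ hmem)
    hb.1 ?_ ?_ ?_ ?_⟩
  · have := (abs_le.1 ha.2).1
    linarith
  · exact (abs_le.1 hb.2).2
  · intro c hc
    by_contra hlt
    have hci : c ≤ i := by have := F.min'_le _ hmem; omega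
    have : c ∈ F := (key c).2 ⟨hS _ _ hci hi, by
      have := hx c i hci hi
      rw [abs_le]; constructor <;> linarith⟩
    have := F.min'_le _ this
    omega
  · intro hbS
    by_contra hlt
    have hci : i ≤ F.max' hne + 1 := by have := F.le_max' _ hmem; omega
    have : F.max' hne + 1 ∈ F := (key _).2 ⟨hbS, by
      have := hx i _ hci hbS
      rw [abs_le]; constructor <;> linarith⟩
    have := F.le_max' _ this
    omega

lemma IsWindow.mono {i j a b a' b' : ℕ} (hS : ∀ i j, i ≤ j → j ∈ S → i ∈ S)
    (hx : ∀ i j, i ≤ j → j ∈ S → x i ≤ x j) (hij : i ≤ j) (h : IsWindow θ S x i a b)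
    (h' : IsWindow θ S x j a' b') : a ≤ a' ∧ b ≤ b' := by
  have hi := hS _ _ h.le_right h.right_mem
  have hj := hS _ _ h'.le_right h'.right_mem
  have ha' := hS _ _ (h'.left_le.trans h'.le_right) h'.right_mem
  have hxij := hx _ _ hij hj
  constructor
  · by_contra hlt
    have h1 := (h'.near_iff a' ha').2 ⟨le_rfl, h'.left_le.trans h'.le_right⟩
    have h2 := mt (h.near_iff a' ha').1 (by omega)
    have h3 := hx a' i (by have := h.left_le; omega) hi
    rw [abs_le] at h1 h2
    exact h2 ⟨by linarith, by linarith⟩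
  · by_contra hlt
    have h1 := (h.near_iff b h.right_mem).2 ⟨h.left_le.trans h.le_right, le_rfl⟩
    have h2 := mt (h'.near_iff b h.right_mem).1 (by omega)
    have h3 := hx j b (by have := h'.le_right; omega) h.right_mem
    rw [abs_le] at h1 h2
    exact h2 ⟨by linarith, by linarith⟩

/-- An update preserves the order of the opinions. -/
lemma mono_of_update {x' : ℕ → ℝ} (hS : ∀ i j, i ≤ j → j ∈ S → i ∈ S)
    (hx : ∀ i j, i ≤ j → j ∈ S → x i ≤ x j) (hw : ∀ i ∈ S, ∃ a b, IsWindow θ S x i a b)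
    (hu : ∀ i ∈ S, ∀ a b, IsWindow θ S x i a b → x' i = windowMean x a b) :
    ∀ i j, i ≤ j → j ∈ S → x' i ≤ x' j := by
  intro i j hij hj
  have hi := hS _ _ hij hj
  obtain ⟨a, b, h⟩ := hw i hi
  obtain ⟨a', b', h'⟩ := hw j hj
  rw [hu i hi a b h, hu j hj a' b' h']
  obtain ⟨h1, h2⟩ := h.mono hS hx hij h'
  exact windowMean_mono (h.left_le.trans h.le_right) (h'.left_le.trans h'.le_right) h1 h2
    fun k l hkl hl => hx k l hkl (hS _ _ hl h'.right_mem)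

end Window

namespace IsEvolution

variable {θ : ℝ} {S : Set ℕ} {X : ℕ → ℕ → ℝ}

lemma eq_succ (hX : IsEvolution θ S X) (hθ : 0 ≤ θ) {t i j : ℕ} (hi : i ∈ S) (hj : j ∈ S)
    (h : X t i = X t j) : X (t + 1) i = X (t + 1) j := by
  obtain ⟨a, b, hw⟩ := hX.exists_window t i hi
  have hm := (hw.near_iff j hj).1 (by rw [h]; simpa using hθ)
  rw [hX.update t i hi a b hw, hX.update t j hj a b
    ⟨hm.1, hm.2, hw.right_mem, fun k hk => by rw [← h]; exact hw.near_iff k hk⟩]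

lemma eq_of_le (hX : IsEvolution θ S X) (hθ : 0 ≤ θ) {t t' i j : ℕ} (ht : t ≤ t') (hi : i ∈ S)
    (hj : j ∈ S) (h : X t i = X t j) : X t' i = X t' j := by
  induction t', ht using Nat.le_induction with
  | base => exact h
  | succ n _ ih => exact hX.eq_succ hθ hi hj ih

lemma gap_succ (hX : IsEvolution θ S X) {t k : ℕ} (hk : k + 1 ∈ S)
    (h : θ < X t (k + 1) - X t k) : θ < X (t + 1) (k + 1) - X (t + 1) k := by
  have hk' : k ∈ S := hX.lower _ _ (Nat.le_succ k) hk
  obtain ⟨a, b, hw⟩ := hX.exists_window t k hk'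
  obtain ⟨a', b', hw'⟩ := hX.exists_window t (k + 1) hk
  have hb : b ≤ k := by
    by_contra hlt
    have := (hw.near_iff (k + 1) hk).2 ⟨by have := hw.left_le; omega, by omega⟩
    exact absurd ((le_abs_self _).trans this) (by linarith)
  have ha : k + 1 ≤ a' := by
    by_contra hlt
    have := (hw'.near_iff k hk').2 ⟨by omega, by have := hw'.le_right; omega⟩
    rw [abs_sub_comm] at this
    exact absurd ((le_abs_self _).trans this) (by linarith)
  rw [hX.update t k hk' a b hw, hX.update t (k + 1) hk a' b' hw']
  have h1 : windowMean (X t) a b ≤ X t k :=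
    windowMean_le (hw.left_le.trans hw.le_right) fun l _ hl => hX.mono t _ _ (hl.trans hb) hk'
  have h2 : X t (k + 1) ≤ windowMean (X t) a' b' :=
    le_windowMean (hw'.left_le.trans hw'.le_right) fun l hl hl' =>
      hX.mono t _ _ (ha.trans hl) (hX.lower _ _ hl' hw'.right_mem)
  linarith

/-- A gap larger than the confidence bound never closes. -/
lemma gap_of_le (hX : IsEvolution θ S X) {t t' k : ℕ} (ht : t ≤ t') (hk : k + 1 ∈ S)
    (h : θ < X t (k + 1) - X t k) : θ < X t' (k + 1) - X t' k := by
  induction t', ht using Nat.le_induction with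
  | base => exact h
  | succ n _ ih => exact hX.gap_succ hk ih

/-- A block of agents that is separated from the others at time `T` evolves on its own. -/
theorem block (hX : IsEvolution θ S X) (T s : ℕ) {S' : Set ℕ}
    (hS' : ∀ i j, i ≤ j → j ∈ S' → i ∈ S') (hsub : ∀ i ∈ S', s + i ∈ S)
    (hl : ∀ s', s' + 1 = s → s ∈ S → θ < X T s - X T s')
    (hr : ∀ i ∈ S', i + 1 ∉ S' → s + i + 1 ∈ S → θ < X T (s + i + 1) - X T (s + i)) :
    IsEvolution θ S' (fun t i => X (T + t) (s + i)) := by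
  have key : ∀ t, ∀ i ∈ S', ∃ a b, IsWindow θ S (X (T + t)) (s + i) (s + a) (s + b) ∧
      IsWindow θ S' (fun i => X (T + t) (s + i)) i a b := by
    intro t i hi
    obtain ⟨a, b, hw⟩ := hX.exists_window (T + t) (s + i) (hsub i hi)
    have h1 := hw.left_le
    have h2 := hw.le_right
    have hsS : s ∈ S := hX.lower _ _ (by omega) (hsub i hi)
    have ha : s ≤ a := by
      by_contra hlt
      obtain ⟨s', rfl⟩ : ∃ s', s = s' + 1 := ⟨s - 1, by omega⟩
      have h3 := hX.gap_of_le (Nat.le_add_right T t) hsS (hl s' rfl hsS)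
      have h4 := (hw.near_iff s' (hX.lower _ _ (by omega) hsS)).2 ⟨by omega, by omega⟩
      have h5 := hX.mono (T + t) (s' + 1) (s' + 1 + i) (by omega) (hsub i hi)
      have := (abs_le.1 h4).1
      linarith
    have hb : b - s ∈ S' := by
      by_contra hnot
      have hex : ∃ e, i ≤ e ∧ e ∈ S' ∧ e + 1 ∉ S' ∧ s + e + 1 ≤ b := by
        have hP : ∃ e, i + e ∉ S' := ⟨b - s - i, by rwa [show i + (b - s - i) = b - s by omega]⟩
        classical
        have hne := Nat.find_spec hP
        have hpos : Nat.find hP ≠ 0 := fun h0 => by rw [h0] at hne; exact hne hi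
        have hmin := Nat.find_min hP (m := Nat.find hP - 1) (by omega)
        have hle := Nat.find_min' hP (m := b - s - i)
          (by rwa [show i + (b - s - i) = b - s by omega])
        refine ⟨i + (Nat.find hP - 1), by omega, not_not.1 hmin, ?_, by omega⟩
        rwa [show i + (Nat.find hP - 1) + 1 = i + Nat.find hP by omega]
      obtain ⟨e, he1, he2, he3, he4⟩ := hex
      have hmem : s + e + 1 ∈ S := hX.lower _ _ he4 hw.right_mem
      have h3 := hX.gap_of_le (Nat.le_add_right T t) hmem (hr e he2 he3 hmem)
      have h4 := (hw.near_iff (s + e + 1) hmem).2 ⟨by omega, by omega⟩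
      have h5 := hX.mono (T + t) (s + i) (s + e) (by omega) (hsub e he2)
      have := (abs_le.1 h4).2
      linarith
    refine ⟨a - s, b - s, ?_, ⟨by omega, by omega, hb, ?_⟩⟩
    · rwa [show s + (a - s) = a by omega, show s + (b - s) = b by omega]
    · intro j hj
      rw [hw.near_iff (s + j) (hsub j hj)]
      omega
  refine ⟨hS', fun t i j hij hj => hX.mono _ _ _ (by omega) (hsub j hj), ?_, ?_⟩
  · intro t i hi
    obtain ⟨a, b, _, h⟩ := key t i hi
    exact ⟨a, b, h⟩
  · intro t i hi a b hw
    obtain ⟨a', b', h1, h2⟩ := key t i hi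
    obtain ⟨rfl, rfl⟩ := hw.unique hS' h2
    rw [windowMean_shift]
    exact hX.update (T + t) (s + i) (hsub i hi) _ _ h1

/-- The mirror image of an evolution of finitely many agents. -/
theorem reflect {m : ℕ} (hX : IsEvolution θ (Set.Iio m) X) :
    IsEvolution θ (Set.Iio m) (fun t i => -X t (m - 1 - i)) := by
  have key : ∀ t i a b, i < m → IsWindow θ (Set.Iio m) (X t) (m - 1 - i) a b →
      IsWindow θ (Set.Iio m) (fun i => -X t (m - 1 - i)) i (m - 1 - b) (m - 1 - a) := by
    intro t i a b hi hw
    have h1 := hw.left_le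
    have h2 := hw.le_right
    have h3 : b < m := hw.right_mem
    refine ⟨by omega, by omega, Set.mem_Iio.2 (by omega), fun j hj => ?_⟩
    have hj' : j < m := hj
    have := hw.near_iff (m - 1 - j) (Set.mem_Iio.2 (by omega))
    rw [neg_sub_neg, abs_sub_comm, this]
    omega
  have hlow : ∀ i j, i ≤ j → j ∈ Set.Iio m → i ∈ Set.Iio m := fun i j h hj => lt_of_le_of_lt h hj
  refine ⟨hlow, ?_, ?_, ?_⟩
  · intro t i j hij hj
    have hj' : j < m := hj
    exact neg_le_neg (hX.mono t _ _ (by omega) (Set.mem_Iio.2 (by omega)))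
  · intro t i hi
    have hi' : i < m := hi
    obtain ⟨a, b, h⟩ := hX.exists_window t (m - 1 - i) (Set.mem_Iio.2 (by omega))
    exact ⟨_, _, key t i a b hi h⟩
  · intro t i hi a b hw
    have hi' : i < m := hi
    have hmi : m - 1 - i ∈ Set.Iio m := Set.mem_Iio.2 (by omega)
    obtain ⟨a', b', h⟩ := hX.exists_window t (m - 1 - i) hmi
    obtain ⟨rfl, rfl⟩ := hw.unique hlow (key t i a' b' hi h)
    have h1 := h.left_le
    have h2 := h.le_right
    have h3 : b' < m := h.right_mem
    rw [windowMean_neg, windowMean_reflect _ (by omega) (by omega), hX.update t _ hmi _ _ h,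
      show m - 1 - (m - 1 - a') = a' by omega, show m - 1 - (m - 1 - b') = b' by omega]

/-- A separated block of agents, any two of which are neighbours, collapses in one step. -/
lemma collapse (hX : IsEvolution θ S X) {t a b : ℕ} (hab : a ≤ b) (hb : b ∈ S)
    (hspan : X t b - X t a ≤ θ) (hl : ∀ c, c + 1 = a → θ < X t a - X t c)
    (hr : b + 1 ∈ S → θ < X t (b + 1) - X t b) : X (t + 1) a = X (t + 1) b := by
  have ha := hX.lower _ _ hab hb
  have h1 := hX.mono t a b hab hb
  have h0 : (0 : ℝ) ≤ θ := by linarith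
  rw [hX.update t a ha a b, hX.update t b hb a b]
  · exact isWindow_of_mono hX.lower (hX.mono t) hab le_rfl hb hspan (by simpa using h0)
      (fun c hc => by have := hl c hc; linarith) hr
  · exact isWindow_of_mono hX.lower (hX.mono t) le_rfl hab hb (by simpa using h0) hspan hl
      (fun h => by have := hr h; linarith)

end IsEvolution
/-! ### Certified integer bounds for one update -/

/-- Evaluates `n` before passing it on, so that kernel reduction shares the numeral. -/
def force {α : Type} (n : ℕ) (k : ℕ → α) : α :=
  match n with
  | 0 => k 0
  | m + 1 => k (m + 1)

lemma force_eq {α : Type} (n : ℕ) (k : ℕ → α) : force n k = k n := by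
  cases n <;> rfl

/-- The number, and the sums of the components, of the initial elements of a list that are `near`.
The first other element must be `far`; `atEnd` tells whether the list may be used up. -/
def scan (near far : ℕ × ℕ → Bool) (atEnd : Bool) : List (ℕ × ℕ) → Option (ℕ × ℕ × ℕ)
  | [] => if atEnd then some (0, 0, 0) else none
  | p :: r =>
    if near p then
      match scan near far atEnd r with
      | some (n, l, h) => some (n + 1, p.1 + l, p.2 + h)
      | none => none
    else if far p then some (0, 0, 0) else none

/-- Lower and upper position of an agent after an update, scaled by `420`. The list `bef` holds
the agents before it, nearest first, and `aft` those after it. Opinions differing by at most `tl`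
according to the upper positions are near, those differing by at least `th` according to the lower
positions are far; the result is `none` if this leaves a doubt about the neighbours. -/
def newPos (closed : Bool) (tl th : ℕ) (bef : List (ℕ × ℕ)) (p : ℕ × ℕ) (aft : List (ℕ × ℕ)) :
    Option (ℕ × ℕ) :=
  match scan (fun q => Nat.ble p.2 (q.2 + tl)) (fun q => Nat.ble (q.1 + th) p.1) true bef,
    scan (fun q => Nat.ble q.2 (p.2 + tl)) (fun q => Nat.ble (p.1 + th) q.1) closed aft with
  | some (n, l, h), some (n', l', h') =>
    if Nat.beq (420 % (n + n' + 1)) 0 then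
      some (420 / (n + n' + 1) * (l + (p.1 + l')), 420 / (n + n' + 1) * (h + (p.2 + h')))
    else none
  | _, _ => none

/-- The update of lower and upper positions, up to the first agent whose neighbours are in
doubt. -/
def stepList (closed : Bool) (tl th : ℕ) : List (ℕ × ℕ) → List (ℕ × ℕ) → List (ℕ × ℕ)
  | _, [] => []
  | bef, p :: r =>
    match newPos closed tl th bef p r with
    | some (l, h) => force l fun l => force h fun h => (l, h) :: stepList closed tl th (p :: bef) r
    | none => []

/-- The lower positions in a list of pairs of bounds. -/
def lo (P : List (ℕ × ℕ)) (k : ℕ) : ℕ := (P.getD k (0, 0)).1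

/-- The upper positions in a list of pairs of bounds. -/
def hi (P : List (ℕ × ℕ)) (k : ℕ) : ℕ := (P.getD k (0, 0)).2

lemma scan_spec {near far : ℕ × ℕ → Bool} {e : Bool} {P : List (ℕ × ℕ)} {n l h : ℕ}
    (hs : scan near far e P = some (n, l, h)) :
    n ≤ P.length ∧ l = ∑ k ∈ Finset.range n, lo P k ∧ h = ∑ k ∈ Finset.range n, hi P k ∧
      (∀ k < n, near (P.getD k (0, 0)) = true) ∧
      (n < P.length → far (P.getD n (0, 0)) = true) ∧ (n = P.length → e = true) := by
  induction P generalizing n l h with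
  | nil =>
    cases e <;> simp [scan] at hs
    obtain ⟨rfl, rfl, rfl⟩ := hs
    simp
  | cons p r ih =>
    rw [scan] at hs
    split_ifs at hs with h1 h2
    · split at hs
      · rename_i n' l' h' heq
        obtain ⟨i1, i2, i3, i4, i5, i6⟩ := ih heq
        simp only [Option.some.injEq, Prod.mk.injEq] at hs
        obtain ⟨rfl, rfl, rfl⟩ := hs
        refine ⟨by simpa using i1, ?_, ?_, ?_, ?_, ?_⟩
        · rw [Finset.sum_range_succ', i2, add_comm]
          rfl
        · rw [Finset.sum_range_succ', i3, add_comm]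
          rfl
        · rintro (_ | k) hk
          · simpa using h1
          · simpa using i4 k (by omega)
        · intro hn
          simpa using i5 (by simpa using hn)
        · intro hn
          exact i6 (by simpa using hn)
      · simp at hs
    · simp only [Option.some.injEq, Prod.mk.injEq] at hs
      obtain ⟨rfl, rfl, rfl⟩ := hs
      simpa using h2

lemma stepList_spec {closed : Bool} {tl th : ℕ} {bef P : List (ℕ × ℕ)} {i : ℕ}
    (hi : i < (stepList closed tl th bef P).length) :
    i < P.length ∧ newPos closed tl th ((P.take i).reverse ++ bef) (P.getD i (0, 0))
      (P.drop (i + 1)) = some ((stepList closed tl th bef P).getD i (0, 0)) := by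
  induction P generalizing bef i with
  | nil => simp [stepList] at hi
  | cons p r ih =>
    simp only [stepList, force_eq] at hi ⊢
    split at hi
    · rename_i l h heq
      cases i with
      | zero => simpa using heq
      | succ i =>
        obtain ⟨h1, h2⟩ := ih (bef := p :: bef) (i := i) (by simpa using hi)
        refine ⟨by simpa using h1, ?_⟩
        simpa using h2
    · simp at hi

lemma sum_Icc_around (f : ℕ → ℕ) (i n n' : ℕ) (hn : n ≤ i) :
    ∑ k ∈ Finset.Icc (i - n) (i + n'), f k =
      ∑ k ∈ Finset.range n, f (i - 1 - k) + (f i + ∑ k ∈ Finset.range n', f (i + 1 + k)) := by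
  induction n with
  | zero =>
    induction n' with
    | zero => simp
    | succ n' ih =>
      rw [← add_assoc, Finset.sum_Icc_succ_top (by omega), ih, Finset.sum_range_succ,
        show i + n' + 1 = i + 1 + n' by omega]
      ring
  | succ n ih =>
    rw [Finset.sum_range_succ, ← Finset.insert_Icc_add_one_left_eq_Icc (by omega),
      Finset.sum_insert (by simp), show i - (n + 1) + 1 = i - n by omega, ih (by omega),
      show i - 1 - n = i - (n + 1) by omega]
    ring

/-- What the computation of the `i`-th entry of `stepList` certifies: the neighbours are
`a, …, b`, and the new bounds are `420` times the means of the old ones over these agents. -/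
structure RowCert (closed : Bool) (tl th : ℕ) (P P' : List (ℕ × ℕ)) (i a b : ℕ) : Prop where
  left_le : a ≤ i
  le_right : i ≤ b
  lt_length : b < P.length
  near_left : hi P i ≤ hi P a + tl
  near_right : hi P b ≤ hi P i + tl
  far_left : ∀ c, c + 1 = a → lo P c + th ≤ lo P i
  far_right : b + 1 < P.length → lo P i + th ≤ lo P (b + 1)
  closed_of_last : b + 1 = P.length → closed = true
  dvd : b + 1 - a ∣ 420
  lo_eq : lo P' i = 420 / (b + 1 - a) * ∑ k ∈ Finset.Icc a b, lo P k
  hi_eq : hi P' i = 420 / (b + 1 - a) * ∑ k ∈ Finset.Icc a b, hi P k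

theorem exists_rowCert {closed : Bool} {tl th : ℕ} {P : List (ℕ × ℕ)} {i : ℕ}
    (hi' : i < (stepList closed tl th [] P).length) :
    ∃ a b, RowCert closed tl th P (stepList closed tl th [] P) i a b := by
  obtain ⟨hlen, h⟩ := stepList_spec hi'
  rw [List.append_nil, newPos] at h
  split at h
  · rename_i n l u n' l' u' h1 h2
    split_ifs at h with hd
    obtain ⟨a1, a2, a3, a4, a5, a6⟩ := scan_spec h1
    obtain ⟨b1, b2, b3, b4, b5, b6⟩ := scan_spec h2
    rw [List.length_reverse, List.length_take, min_eq_left hlen.le] at a1 a5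
    rw [List.length_drop] at b1 b5 b6
    have hbef : ∀ k < i, (P.take i).reverse.getD k (0, 0) = P.getD (i - 1 - k) (0, 0) := by
      intro k hk
      rw [List.getD_eq_getElem _ _ (by simp; omega), List.getD_eq_getElem _ _ (by omega)]
      simp only [List.getElem_reverse, List.getElem_take, List.length_take, min_eq_left hlen.le]
    have haft : ∀ k, (P.drop (i + 1)).getD k (0, 0) = P.getD (i + 1 + k) (0, 0) := by
      intro k
      simp [List.getD]
    have hcnt : i + n' + 1 - (i - n) = n + n' + 1 := by omega
    refine ⟨i - n, i + n', by omega, by omega, by omega, ?_, ?_, ?_, ?_, ?_, ?_, ?_, ?_⟩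
    · rcases Nat.eq_zero_or_pos n with rfl | hn
      · simp
      · have := a4 (n - 1) (by omega)
        rw [hbef _ (by omega), show i - 1 - (n - 1) = i - n by omega] at this
        exact Nat.le_of_ble_eq_true this
    · rcases Nat.eq_zero_or_pos n' with rfl | hn
      · simp
      · have := b4 (n' - 1) (by omega)
        rw [haft, show i + 1 + (n' - 1) = i + n' by omega] at this
        exact Nat.le_of_ble_eq_true this
    · intro c hc
      have := a5 (by omega)
      rw [hbef _ (by omega), show i - 1 - n = c by omega] at this
      exact Nat.le_of_ble_eq_true this
    · intro hb
      have := b5 (by omega)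
      rw [haft, show i + 1 + n' = i + n' + 1 by omega] at this
      exact Nat.le_of_ble_eq_true this
    · intro hb
      exact b6 (by omega)
    · rw [hcnt]
      exact Nat.dvd_of_mod_eq_zero (Nat.eq_of_beq_eq_true hd)
    · rw [hcnt, sum_Icc_around _ _ _ _ a1]
      have e : (stepList closed tl th [] P).getD i (0, 0) = _ := (Option.some.inj h).symm
      have s1 : ∑ k ∈ Finset.range n, lo (P.take i).reverse k =
          ∑ k ∈ Finset.range n, lo P (i - 1 - k) :=
        Finset.sum_congr rfl fun k hk => by
          rw [lo, hbef k (by have := Finset.mem_range.1 hk; omega), lo]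
      have s2 : ∑ k ∈ Finset.range n', lo (P.drop (i + 1)) k =
          ∑ k ∈ Finset.range n', lo P (i + 1 + k) :=
        Finset.sum_congr rfl fun k _ => by rw [lo, haft, lo]
      rw [← s1, ← s2, ← a2, ← b2, lo, e]
      rfl
    · rw [hcnt, sum_Icc_around _ _ _ _ a1]
      have e : (stepList closed tl th [] P).getD i (0, 0) = _ := (Option.some.inj h).symm
      have s1 : ∑ k ∈ Finset.range n, HK.hi (P.take i).reverse k =
          ∑ k ∈ Finset.range n, HK.hi P (i - 1 - k) :=
        Finset.sum_congr rfl fun k hk => by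
          rw [HK.hi, hbef k (by have := Finset.mem_range.1 hk; omega), HK.hi]
      have s2 : ∑ k ∈ Finset.range n', HK.hi (P.drop (i + 1)) k =
          ∑ k ∈ Finset.range n', HK.hi P (i + 1 + k) :=
        Finset.sum_congr rfl fun k _ => by rw [HK.hi, haft, HK.hi]
      rw [← s1, ← s2, ← a3, ← b3, HK.hi, e]
      rfl
  · simp at h

/-- At scale `c`, the distances between the agents listed in `P` lie between those of the lower and
those of the upper positions. -/
def Encloses (c : ℝ) (P : List (ℕ × ℕ)) (y : ℕ → ℝ) : Prop :=
  ∀ i j, i ≤ j → j < P.length → (lo P j : ℝ) - lo P i ≤ c * (y j - y i) ∧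
    c * (y j - y i) ≤ (hi P j : ℝ) - hi P i

lemma windowMean_lin (c : ℝ) (y z : ℕ → ℝ) (a b : ℕ) :
    windowMean (fun k => c * y k - z k) a b = c * windowMean y a b - windowMean z a b := by
  simp only [windowMean, Finset.sum_sub_distrib, ← Finset.mul_sum]
  ring

lemma RowCert.isWindow {closed : Bool} {tl th : ℕ} {P P' : List (ℕ × ℕ)} {i a b : ℕ} {c θ : ℝ}
    {S : Set ℕ} {x : ℕ → ℝ} (h : RowCert closed tl th P P' i a b) (hc : 0 < c)
    (htl : tl ≤ c * θ) (hth : c * θ < th) (hS : ∀ i j, i ≤ j → j ∈ S → i ∈ S)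
    (hx : ∀ i j, i ≤ j → j ∈ S → x i ≤ x j) (hP : ∀ k < P.length, k ∈ S)
    (hcl : closed = true → ∀ k ∈ S, k < P.length) (he : Encloses c P x) :
    IsWindow θ S x i a b := by
  have hb := h.lt_length
  have hai := h.left_le
  have hib := h.le_right
  have nl : (hi P i : ℝ) ≤ hi P a + tl := by exact_mod_cast h.near_left
  have nr : (hi P b : ℝ) ≤ hi P i + tl := by exact_mod_cast h.near_right
  refine isWindow_of_mono hS hx hai hib (hP _ hb) ?_ ?_ ?_ ?_
  · have := (he a i hai (by omega)).2
    exact le_of_mul_le_mul_left (by linarith) hc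
  · have := (he i b hib hb).2
    exact le_of_mul_le_mul_left (by linarith) hc
  · intro d hd
    have := (he d i (by omega) (by omega)).1
    have h2 : (lo P d : ℝ) + th ≤ lo P i := by exact_mod_cast h.far_left d hd
    exact lt_of_mul_lt_mul_left (by linarith) hc.le
  · intro hbS
    have hlt : b + 1 < P.length := by
      rcases Nat.lt_or_ge (b + 1) P.length with hlt | hge
      · exact hlt
      · exact hcl (h.closed_of_last (by omega)) _ hbS
    have := (he i (b + 1) (by omega) hlt).1
    have h2 : (lo P i : ℝ) + th ≤ lo P (b + 1) := by exact_mod_cast h.far_right hlt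
    exact lt_of_mul_lt_mul_left (by linarith) hc.le

lemma cast_div_mul_sum {a b : ℕ} (hab : a ≤ b) (hd : b + 1 - a ∣ 420) (f : ℕ → ℕ) :
    ((420 / (b + 1 - a) * ∑ k ∈ Finset.Icc a b, f k : ℕ) : ℝ) =
      420 * windowMean (fun k => (f k : ℝ)) a b := by
  have h0 : ((b + 1 - a : ℕ) : ℝ) = (b : ℝ) + 1 - a := by
    rw [Nat.cast_sub (by omega)]
    push_cast
    ring
  have h1 : ((b + 1 - a : ℕ) : ℝ) ≠ 0 := by
    rw [Nat.cast_ne_zero]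
    omega
  rw [windowMean, ← h0, Nat.cast_mul, Nat.cast_div hd h1]
  push_cast
  field_simp

/-- The comparison principle: bounds for the distances are carried over by an update. -/
theorem Encloses.step {closed : Bool} {tl th : ℕ} {P : List (ℕ × ℕ)} {c θ : ℝ} {S : Set ℕ}
    {X : ℕ → ℕ → ℝ} {t : ℕ} (hX : IsEvolution θ S X) (hc : 0 < c)
    (htl : tl ≤ c * θ) (hth : c * θ < th) (hP : ∀ k < P.length, k ∈ S)
    (hcl : closed = true → ∀ k ∈ S, k < P.length) (he : Encloses c P (X t)) :
    Encloses (420 * c) (stepList closed tl th [] P) (X (t + 1)) := by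
  intro i j hij hj
  obtain ⟨a, b, hi'⟩ := exists_rowCert (hij.trans_lt hj)
  obtain ⟨a', b', hj'⟩ := exists_rowCert hj
  have wi := hi'.isWindow hc htl hth hX.lower (hX.mono t) hP hcl he
  have wj := hj'.isWindow hc htl hth hX.lower (hX.mono t) hP hcl he
  obtain ⟨haa, hbb⟩ := wi.mono hX.lower (hX.mono t) hij wj
  have hab := wi.left_le.trans wi.le_right
  have hab' := wj.left_le.trans wj.le_right
  rw [hX.update t i (hX.lower _ _ wi.le_right wi.right_mem) a b wi,
    hX.update t j (hX.lower _ _ wj.le_right wj.right_mem) a' b' wj,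
    hi'.lo_eq, hj'.lo_eq, hi'.hi_eq, hj'.hi_eq, cast_div_mul_sum hab hi'.dvd,
    cast_div_mul_sum hab' hj'.dvd, cast_div_mul_sum hab hi'.dvd, cast_div_mul_sum hab' hj'.dvd]
  have hb' := hj'.lt_length
  have h1 := windowMean_mono (z := fun k => c * X t k - lo P k) hab hab' haa hbb
    fun k l hkl hl => by
      have := (he k l hkl (by omega)).1
      show c * X t k - lo P k ≤ c * X t l - lo P l
      linarith
  have h2 := windowMean_mono (z := fun k => c * -X t k - -(hi P k : ℝ)) hab hab' haa hbb
    fun k l hkl hl => by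
      have := (he k l hkl (by omega)).2
      show c * -X t k - -(hi P k : ℝ) ≤ c * -X t l - -(hi P l : ℝ)
      linarith
  rw [windowMean_lin, windowMean_lin] at h1 h2
  rw [windowMean_neg, windowMean_neg, windowMean_neg, windowMean_neg] at h2
  constructor <;> linarith

/-! ### Computations with certified bounds -/

/-- The integer that stands for the initial spacing. It is divisible by the denominators of the
tolerances that occur and of the bounds `61 / 50` and `123 / 100` for the confidence radius. -/
def unit : ℕ := 100 * 2 ^ 26

/-- The tolerance for the `i`-th gap among `m` agents, in multiples of `1 / unit`. -/
def natTol (m i : ℕ) : ℕ := if m ≤ 6 then 100 * 2 ^ 20 else 100 * 2 ^ (20 - min i (m - 2 - i))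

/-- Bounds for the positions of `n + 1` agents from `k` on, whose gaps deviate by at most `w` from
`unit`. -/
def initList (w : ℕ → ℕ) : ℕ → ℕ → ℕ → ℕ → List (ℕ × ℕ)
  | 0, _, l, h => [(l, h)]
  | n + 1, k, l, h =>
    (l, h) :: force (l + (unit - w k)) fun l => force (h + (unit + w k)) fun h =>
      initList w n (k + 1) l h

/-- The lower bound `61 / 50` for the confidence radius, at the scale of time `t`. -/
def tl (t : ℕ) : ℕ := 122 * 2 ^ 26 * 420 ^ t

/-- The upper bound `123 / 100` for the confidence radius, at the scale of time `t`. -/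
def th (t : ℕ) : ℕ := 123 * 2 ^ 26 * 420 ^ t

/-- The bounds after `n` updates, starting from `P` at time `t`. -/
def iterList (closed : Bool) (t : ℕ) (P : List (ℕ × ℕ)) : ℕ → List (ℕ × ℕ)
  | 0 => P
  | n + 1 => stepList closed (tl (t + n)) (th (t + n)) [] (iterList closed t P n)

/-- Tests the bounds with `f` before each of `n` updates, and with `g` after the last one. -/
def checkRun (closed : Bool) (f : ℕ → List (ℕ × ℕ) → Bool) (g : List (ℕ × ℕ) → Bool) :
    ℕ → ℕ → List (ℕ × ℕ) → Bool
  | 0, _, P => g P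
  | n + 1, t, P => f t P && checkRun closed f g n (t + 1) (stepList closed (tl t) (th t) [] P)

/-- All gaps are at most `c`, according to the upper positions. -/
def gapsLe (c : ℕ) : List (ℕ × ℕ) → Bool
  | p :: q :: r => Nat.ble q.2 (p.2 + c) && gapsLe c (q :: r)
  | _ => true

/-- All gaps are at least `c / 2`, according to the lower positions. -/
def gapsGe (c : ℕ) : List (ℕ × ℕ) → Bool
  | p :: q :: r => Nat.ble (2 * p.1 + c) (2 * q.1) && gapsGe c (q :: r)
  | _ => true

/-- The `i`-th gap is within the `w`-neighbourhood of `unit` at time `8`. -/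
def gapWithin (w i : ℕ) (P : List (ℕ × ℕ)) : Bool :=
  Nat.ble (lo P i + (unit - w) * 420 ^ 8) (lo P (i + 1)) &&
    Nat.ble (hi P (i + 1)) (hi P i + (unit + w) * 420 ^ 8)

/-- At time `8` the agents `0, …, 3` are separated from agent `4`, any two of them are neighbours,
and the last two of them differ. -/
def leftDetached (P : List (ℕ × ℕ)) : Bool :=
  Nat.ble (hi P 3) (hi P 0 + tl 8) && Nat.ble (lo P 3 + th 8) (lo P 4) && Nat.blt (lo P 2) (lo P 3)

/-- The mirror image of `leftDetached`, for `m` agents. -/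
def rightDetached (m : ℕ) (P : List (ℕ × ℕ)) : Bool :=
  Nat.ble (hi P (m - 1)) (hi P (m - 4) + tl 8) &&
    Nat.ble (lo P (m - 5) + th 8) (lo P (m - 4)) && Nat.blt (lo P (m - 4)) (lo P (m - 3))

/-- Tests one period of eight updates of `m` agents: they stay connected, four agents detach at each
end, and the others satisfy the tolerances for `m - 8` agents. -/
def closedCheck (m : ℕ) : Bool :=
  checkRun true (fun t P => Nat.beq P.length m && gapsLe (tl t) P)
    (fun P => Nat.beq P.length m && leftDetached P && rightDetached m P &&
      (List.range (m - 9)).all fun i => gapWithin (natTol (m - 8) i) (i + 4) P)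
    8 0 (initList (natTol m) (m - 1) 0 0 0)

/-- The tolerances at the left end of many agents, with a crude value far from the end. -/
def openTol (i : ℕ) : ℕ := if i < 20 then 100 * 2 ^ (20 - i) else 100 * 2 ^ 20

/-- Bounds for the first `29` agents out of at least `44`, at the start of a period. -/
def openList : List (ℕ × ℕ) := initList openTol 28 0 0 0

/-- Tests one period of eight updates at the left end of many agents. The two last agents of the
list are lost in every update, since their neighbours are not all listed. -/
def openCheck : Bool :=
  checkRun false (fun t P => Nat.beq P.length (29 - 2 * t) && gapsLe (tl t) P &&
      gapsGe (th t) (P.drop 2))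
    (fun P => Nat.beq P.length 13 && leftDetached P &&
      (List.range 8).all fun i => gapWithin (100 * 2 ^ (20 - i)) (i + 4) P)
    8 0 openList

/-- Tests the last `m` agents: they form one component and collapse within eleven updates, to one
cluster unless `m = 6`, when they form two clusters of three. -/
def finalCheck (m : ℕ) : Bool :=
  gapsLe (tl 0) (initList (natTol m) (m - 1) 0 0 0) &&
  checkRun true (fun _ P => Nat.beq P.length m)
    (fun P => Nat.beq P.length m && if m = 6 then
      Nat.beq (hi P 0) (hi P 2) && Nat.ble (lo P 2 + th 11) (lo P 3) && Nat.beq (hi P 3) (hi P 5)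
      else Nat.beq (hi P 0) (hi P (m - 1)))
    11 0 (initList (natTol m) (m - 1) 0 0 0)
lemma gapsLe_spec {c : ℕ} {P : List (ℕ × ℕ)} (h : gapsLe c P = true) {k : ℕ}
    (hk : k + 1 < P.length) : hi P (k + 1) ≤ hi P k + c := by
  induction P generalizing k with
  | nil => simp at hk
  | cons p r ih =>
    cases r with
    | nil => simp at hk
    | cons q r =>
      rw [gapsLe, Bool.and_eq_true] at h
      cases k with
      | zero => exact Nat.le_of_ble_eq_true h.1
      | succ k => exact ih h.2 (by simpa using hk)

lemma gapsGe_spec {c : ℕ} {P : List (ℕ × ℕ)} (h : gapsGe c P = true) {k : ℕ}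
    (hk : k + 1 < P.length) : 2 * lo P k + c ≤ 2 * lo P (k + 1) := by
  induction P generalizing k with
  | nil => simp at hk
  | cons p r ih =>
    cases r with
    | nil => simp at hk
    | cons q r =>
      rw [gapsGe, Bool.and_eq_true] at h
      cases k with
      | zero => exact Nat.le_of_ble_eq_true h.1
      | succ k => exact ih h.2 (by simpa using hk)

lemma iterList_succ (closed : Bool) (t n : ℕ) (P : List (ℕ × ℕ)) :
    iterList closed (t + 1) (stepList closed (tl t) (th t) [] P) n =
      iterList closed t P (n + 1) := by
  induction n with
  | zero => rfl
  | succ n ih => rw [iterList, ih, show t + 1 + n = t + (n + 1) by omega]; rfl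

lemma checkRun_spec {closed : Bool} {f : ℕ → List (ℕ × ℕ) → Bool} {g : List (ℕ × ℕ) → Bool}
    {n t : ℕ} {P : List (ℕ × ℕ)} (h : checkRun closed f g n t P = true) :
    (∀ s < n, f (t + s) (iterList closed t P s) = true) ∧ g (iterList closed t P n) = true := by
  induction n generalizing t P with
  | zero => exact ⟨fun s hs => absurd hs (Nat.not_lt_zero s), h⟩
  | succ n ih =>
    rw [checkRun, Bool.and_eq_true] at h
    obtain ⟨h1, h2⟩ := ih h.2
    rw [iterList_succ] at h2
    refine ⟨?_, h2⟩
    rintro (_ | s) hs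
    · exact h.1
    · have := h1 s (by omega)
      rwa [iterList_succ, show t + 1 + s = t + (s + 1) by omega] at this

lemma initList_spec (w : ℕ → ℕ) (n k l h : ℕ) :
    (initList w n k l h).length = n + 1 ∧ lo (initList w n k l h) 0 = l ∧
      hi (initList w n k l h) 0 = h ∧
      ∀ i < n, lo (initList w n k l h) (i + 1) = lo (initList w n k l h) i + (unit - w (k + i)) ∧
        hi (initList w n k l h) (i + 1) = hi (initList w n k l h) i + (unit + w (k + i)) := by
  induction n generalizing k l h with
  | zero => simp [initList, lo, hi]
  | succ n ih =>
    simp only [initList, force_eq]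
    obtain ⟨h1, h2, h3, h4⟩ := ih (k + 1) (l + (unit - w k)) (h + (unit + w k))
    refine ⟨by simpa using h1, rfl, rfl, ?_⟩
    rintro (_ | i) hi'
    · exact ⟨h2, h3⟩
    · have := h4 i (by omega)
      rwa [show k + 1 + i = k + (i + 1) by omega] at this

lemma encloses_of_gaps {c : ℝ} {P : List (ℕ × ℕ)} {y : ℕ → ℝ}
    (h : ∀ i, i + 1 < P.length → (lo P (i + 1) : ℝ) - lo P i ≤ c * (y (i + 1) - y i) ∧
      c * (y (i + 1) - y i) ≤ (hi P (i + 1) : ℝ) - hi P i) : Encloses c P y := by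
  intro i j hij
  induction j, hij using Nat.le_induction with
  | base => intro _; simp
  | succ j hij ih =>
    intro hj
    have h1 := ih (by omega)
    have h2 := h j hj
    constructor <;> linarith

/-- The bounds at the start enclose every configuration with the given tolerances. -/
lemma encloses_initList {w : ℕ → ℕ} {n : ℕ} {y : ℕ → ℝ} (hw : ∀ i < n, w i ≤ unit)
    (h : ∀ i < n, |y (i + 1) - y i - 1| * unit ≤ w i) :
    Encloses unit (initList w n 0 0 0) y := by
  obtain ⟨h1, _, _, h4⟩ := initList_spec w n 0 0 0
  refine encloses_of_gaps fun i hi' => ?_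
  rw [h1] at hi'
  obtain ⟨e1, e2⟩ := h4 i (by omega)
  have hu : (0 : ℝ) < unit := by norm_num [unit]
  have h5 := h i (by omega)
  rw [← abs_of_pos hu, ← abs_mul, abs_le] at h5
  rw [zero_add] at e1 e2
  rw [e1, e2]
  push_cast [Nat.cast_sub (hw i (by omega))]
  constructor <;> linarith

lemma tl_le {θ : ℝ} (h : 61 / 50 ≤ θ) (t : ℕ) : (tl t : ℝ) ≤ unit * 420 ^ t * θ := by
  have : (0 : ℝ) < 420 ^ t := by positivity
  rw [tl, unit]
  push_cast
  nlinarith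

lemma lt_th {θ : ℝ} (h : θ < 123 / 100) (t : ℕ) : unit * 420 ^ t * θ < (th t : ℝ) := by
  have : (0 : ℝ) < 420 ^ t := by positivity
  rw [th, unit]
  push_cast
  nlinarith

lemma scale_pos (t : ℕ) : (0 : ℝ) < unit * 420 ^ t := by
  have : (0 : ℝ) < unit := by norm_num [unit]
  positivity

theorem Encloses.iterList {closed : Bool} {P : List (ℕ × ℕ)} {θ : ℝ} {S : Set ℕ}
    {X : ℕ → ℕ → ℝ} (hX : IsEvolution θ S X) (h1 : 61 / 50 ≤ θ) (h2 : θ < 123 / 100) {n : ℕ}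
    (hP : ∀ s < n, ∀ k < (iterList closed 0 P s).length, k ∈ S)
    (hcl : closed = true → ∀ s < n, ∀ k ∈ S, k < (HK.iterList closed 0 P s).length)
    (he : Encloses unit P (X 0)) {s : ℕ} (hs : s ≤ n) :
    Encloses (unit * 420 ^ s) (HK.iterList closed 0 P s) (X s) := by
  induction s with
  | zero => simpa [HK.iterList] using he
  | succ s ih =>
    have := (ih (by omega)).step hX (scale_pos s) (tl_le h1 s) (lt_th h2 s) (hP s (by omega))
      (fun h => hcl h s (by omega))
    rw [HK.iterList, zero_add, pow_succ, ← mul_assoc, mul_comm _ (420 : ℝ)]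
    exact this

section Encloses

variable {θ : ℝ} {t : ℕ} {P : List (ℕ × ℕ)} {y : ℕ → ℝ}

lemma Encloses.le_of_hi (he : Encloses (unit * 420 ^ t) P y) (h1 : 61 / 50 ≤ θ) {i j : ℕ}
    (hij : i ≤ j) (hj : j < P.length) (h : hi P j ≤ hi P i + tl t) : y j - y i ≤ θ := by
  have e := (he i j hij hj).2
  have h' : (hi P j : ℝ) ≤ hi P i + tl t := by exact_mod_cast h
  exact le_of_mul_le_mul_left (by linarith [tl_le h1 t]) (scale_pos t)

lemma Encloses.lt_of_lo (he : Encloses (unit * 420 ^ t) P y) (h2 : θ < 123 / 100) {i j : ℕ}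
    (hij : i ≤ j) (hj : j < P.length) (h : lo P i + th t ≤ lo P j) : θ < y j - y i := by
  have e := (he i j hij hj).1
  have h' : (lo P i : ℝ) + th t ≤ lo P j := by exact_mod_cast h
  exact lt_of_mul_lt_mul_left (by linarith [lt_th h2 t]) (scale_pos t).le

lemma Encloses.lt_of_lo_lt (he : Encloses (unit * 420 ^ t) P y) {i j : ℕ}
    (hij : i ≤ j) (hj : j < P.length) (h : lo P i < lo P j) : y i < y j := by
  have e := (he i j hij hj).1
  have h' : (lo P i : ℝ) < lo P j := by exact_mod_cast h
  exact lt_of_mul_lt_mul_left (by nlinarith) (scale_pos t).le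

lemma Encloses.eq_of_hi (he : Encloses (unit * 420 ^ t) P y) {i j : ℕ}
    (hij : i ≤ j) (hj : j < P.length) (hy : y i ≤ y j) (h : hi P i = hi P j) : y i = y j := by
  have e := (he i j hij hj).2
  rw [h, sub_self] at e
  have := scale_pos t
  exact le_antisymm hy (by nlinarith)

lemma Encloses.within (he : Encloses (unit * 420 ^ 8) P y) {i w : ℕ} {ε : ℝ}
    (hi' : i + 1 < P.length) (hw : w ≤ unit) (hε : w ≤ unit * ε) (h : gapWithin w i P = true) :
    |y (i + 1) - y i - 1| ≤ ε := by
  rw [gapWithin, Bool.and_eq_true] at h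
  have h1 : (lo P i : ℝ) + (unit - w) * 420 ^ 8 ≤ lo P (i + 1) := by
    have := Nat.le_of_ble_eq_true h.1
    have h' : ((lo P i + (unit - w) * 420 ^ 8 : ℕ) : ℝ) ≤ (lo P (i + 1) : ℕ) := by
      exact Nat.cast_le.2 this
    rwa [Nat.cast_add, Nat.cast_mul, Nat.cast_sub hw, Nat.cast_pow] at h'
  have h2 : (hi P (i + 1) : ℝ) ≤ hi P i + (unit + w) * 420 ^ 8 := by
    exact_mod_cast Nat.le_of_ble_eq_true h.2
  have e := he i (i + 1) (by omega) hi'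
  have hs := scale_pos 8
  rw [abs_le]
  constructor
  · refine le_of_mul_le_mul_left (a := (unit : ℝ) * 420 ^ 8) ?_ hs
    nlinarith
  · refine le_of_mul_le_mul_left (a := (unit : ℝ) * 420 ^ 8) ?_ hs
    nlinarith

end Encloses

/-! ### One period of the evolution -/

/-- The tolerance for the `i`-th gap among `m` agents at the start of a period. It decays
geometrically away from the two ends, except for the few agents that remain at the end. -/
noncomputable def tol (m i : ℕ) : ℝ := if m ≤ 6 then 1 / 64 else (1 / 2) ^ (6 + min i (m - 2 - i))

/-- The gaps of the `m` agents with opinions `y` equal `1` up to the tolerance `tol`. -/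
def Balanced (m : ℕ) (y : ℕ → ℝ) : Prop := ∀ i, i + 1 < m → |y (i + 1) - y i - 1| ≤ tol m i

/-- The agents `0, …, 3` are separated from agent `4`, any two of them are neighbours, and the last
two of them have different opinions. -/
structure FrontDetached (θ : ℝ) (y : ℕ → ℝ) : Prop where
  span : y 3 - y 0 ≤ θ
  gap : θ < y 4 - y 3
  spread : y 2 < y 3

lemma natTol_le (m i : ℕ) : natTol m i ≤ unit := by
  rw [natTol, unit]
  split_ifs
  · norm_num
  · exact Nat.mul_le_mul le_rfl (Nat.pow_le_pow_right (by norm_num) (by omega))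

lemma natTol_eq {m i : ℕ} (hm : m ≤ 43) (hi : i + 1 < m) : (natTol m i : ℝ) = unit * tol m i := by
  rw [natTol, tol, unit]
  split_ifs
  · norm_num
  · have h : min i (m - 2 - i) ≤ 20 := by omega
    generalize min i (m - 2 - i) = k at h
    have h2 : (2 : ℝ) ^ 20 = 2 ^ (20 - k) * 2 ^ k := by rw [← pow_add]; congr 1; omega
    push_cast
    rw [one_div, inv_pow, pow_add, eq_mul_inv_iff_mul_eq₀ (by positivity)]
    calc 100 * (2 : ℝ) ^ (20 - k) * (2 ^ 6 * 2 ^ k) = 100 * 2 ^ 6 * (2 ^ (20 - k) * 2 ^ k) := by ring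
      _ = _ := by rw [← h2]; norm_num

lemma Balanced.encloses {m : ℕ} {y : ℕ → ℝ} (hm : m ≤ 43) (h : Balanced m y) :
    Encloses unit (initList (natTol m) (m - 1) 0 0 0) y := by
  refine encloses_initList (fun i _ => natTol_le m i) fun i hi => ?_
  rw [natTol_eq hm (by omega), mul_comm]
  exact mul_le_mul_of_nonneg_left (h i (by omega)) (Nat.cast_nonneg _)

lemma frontDetached_of_encloses {θ : ℝ} {P : List (ℕ × ℕ)} {y : ℕ → ℝ}
    (he : Encloses (unit * 420 ^ 8) P y) (h1 : 61 / 50 ≤ θ) (h2 : θ < 123 / 100)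
    (hl : 4 < P.length) (h : leftDetached P = true) : FrontDetached θ y := by
  rw [leftDetached, Bool.and_eq_true, Bool.and_eq_true] at h
  obtain ⟨⟨a, b⟩, c⟩ := h
  exact ⟨he.le_of_hi h1 (by omega) (by omega) (Nat.le_of_ble_eq_true a),
    he.lt_of_lo h2 (by omega) (by omega) (Nat.le_of_ble_eq_true b),
    he.lt_of_lo_lt (by omega) (by omega) (Nat.blt_eq.mp c)⟩

/-- One period of the evolution of `m` agents: they stay connected for eight steps, after which
four agents at each end have detached, and the others are in a similar configuration again. -/
structure PeriodOK (θ : ℝ) (m : ℕ) (Y : ℕ → ℕ → ℝ) : Prop where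
  connected : ∀ t < 8, ∀ i, i + 1 < m → Y t (i + 1) - Y t i ≤ θ
  left : FrontDetached θ (Y 8)
  right : FrontDetached θ (fun i => -Y 8 (m - 1 - i))
  balanced : Balanced (m - 8) (fun i => Y 8 (4 + i))

section Compute
set_option maxRecDepth 100000

theorem closedCheck_eq_true : ∀ m < 44, 8 ≤ m → closedCheck m = true := by decide +kernel

theorem openCheck_eq_true : openCheck = true := by decide +kernel

theorem finalCheck_eq_true : ∀ m < 8, 0 < m → finalCheck m = true := by decide +kernel

end Compute

/-- For few agents, the comparison principle reduces a period to a finite computation. -/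
lemma periodOK_of_lt {θ : ℝ} {m : ℕ} {Y : ℕ → ℕ → ℝ} (hY : IsEvolution θ (Set.Iio m) Y)
    (h1 : 61 / 50 ≤ θ) (h2 : θ < 123 / 100) (hm : 8 ≤ m) (hm' : m < 44) (h0 : Balanced m (Y 0)) :
    PeriodOK θ m Y := by
  obtain ⟨hc, hg⟩ := checkRun_spec (closedCheck_eq_true m hm' hm)
  simp only [Bool.and_eq_true, zero_add, List.all_eq_true, List.mem_range] at hc hg
  obtain ⟨⟨⟨hlen, hL⟩, hR⟩, hW⟩ := hg
  replace hlen := Nat.eq_of_beq_eq_true hlen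
  have he : ∀ s ≤ 8, Encloses _ _ (Y s) := fun s hs =>
    Encloses.iterList (closed := true) hY h1 h2 (n := 8)
      (fun s hs k hk => by rwa [Nat.eq_of_beq_eq_true (hc s hs).1] at hk)
      (fun _ s hs k hk => by rw [Nat.eq_of_beq_eq_true (hc s hs).1]; exact hk)
      (h0.encloses (by omega)) hs
  have he8 := he 8 le_rfl
  refine ⟨?_, frontDetached_of_encloses he8 h1 h2 (by omega) hL, ?_, ?_⟩
  · intro t ht i hi
    have hl := Nat.eq_of_beq_eq_true (hc t ht).1
    exact (he t ht.le).le_of_hi h1 (by omega) (by omega) (gapsLe_spec (hc t ht).2 (by omega))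
  · rw [rightDetached, Bool.and_eq_true, Bool.and_eq_true] at hR
    obtain ⟨⟨a, b⟩, c⟩ := hR
    have a' := he8.le_of_hi h1 (by omega) (by omega) (Nat.le_of_ble_eq_true a)
    have b' := he8.lt_of_lo h2 (by omega) (by omega) (Nat.le_of_ble_eq_true b)
    have c' := he8.lt_of_lo_lt (by omega) (by omega) (Nat.blt_eq.mp c)
    have e3 : m - 1 - 3 = m - 4 := by omega
    have e4 : m - 1 - 4 = m - 5 := by omega
    have e2 : m - 1 - 2 = m - 3 := by omega
    constructor <;> simp only [e2, e3, e4, Nat.sub_zero] <;> linarith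
  · intro i hi
    have := he8.within (by omega) (natTol_le _ _) (natTol_eq (by omega) hi).le
      (hW i (by omega))
    show |Y 8 (4 + (i + 1)) - Y 8 (4 + i) - 1| ≤ _
    rwa [show 4 + (i + 1) = i + 4 + 1 by omega, show 4 + i = i + 4 by omega]

/-- Fewer than eight agents form one component, and collapse within eleven steps. -/
lemma final_collapse {θ : ℝ} {m : ℕ} {Y : ℕ → ℕ → ℝ} (hY : IsEvolution θ (Set.Iio m) Y)
    (h1 : 61 / 50 ≤ θ) (h2 : θ < 123 / 100) (hm : 0 < m) (hm' : m < 8) (h0 : Balanced m (Y 0)) :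
    (∀ i, i + 1 < m → Y 0 (i + 1) - Y 0 i ≤ θ) ∧ (m ≠ 6 → Y 11 0 = Y 11 (m - 1)) ∧
      (m = 6 → Y 11 0 = Y 11 2 ∧ θ < Y 11 3 - Y 11 2 ∧ Y 11 3 = Y 11 5) := by
  have hfin := finalCheck_eq_true m hm' hm
  rw [finalCheck, Bool.and_eq_true] at hfin
  obtain ⟨hc, hg⟩ := checkRun_spec hfin.2
  simp only [Bool.and_eq_true] at hg
  obtain ⟨hlen, hW⟩ := hg
  replace hlen := Nat.eq_of_beq_eq_true hlen
  have he0 := h0.encloses (by omega)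
  have he := Encloses.iterList (closed := true) hY h1 h2 (n := 11)
      (fun s hs k hk => by rwa [Nat.eq_of_beq_eq_true (hc s hs)] at hk)
      (fun _ s hs k hk => by rw [Nat.eq_of_beq_eq_true (hc s hs)]; exact hk) he0 le_rfl
  have hmono : ∀ i j, i ≤ j → j < m → Y 11 i ≤ Y 11 j := hY.mono 11
  refine ⟨?_, ?_, ?_⟩
  · intro i hi
    have hl := (initList_spec (natTol m) (m - 1) 0 0 0).1
    exact Encloses.le_of_hi (t := 0) (by simpa using he0) h1 (by omega) (by omega)
      (gapsLe_spec hfin.1 (by omega))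
  · intro hm6
    rw [if_neg hm6] at hW
    exact he.eq_of_hi (by omega) (by omega) (hmono _ _ (by omega) (by omega))
      (Nat.eq_of_beq_eq_true hW)
  · rintro rfl
    rw [if_pos rfl, Bool.and_eq_true, Bool.and_eq_true] at hW
    obtain ⟨⟨a, b⟩, c⟩ := hW
    exact ⟨he.eq_of_hi (by omega) (by omega) (hmono _ _ (by omega) (by omega))
        (Nat.eq_of_beq_eq_true a),
      he.lt_of_lo h2 (by omega) (by omega) (Nat.le_of_ble_eq_true b),
      he.eq_of_hi (by omega) (by omega) (hmono _ _ (by omega) (by omega))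
        (Nat.eq_of_beq_eq_true c)⟩

/-! ### A period far from the other end -/

/-- The opinions `y` at the start of a period, seen from the left end of many agents. The
deviations of the gaps from `1` are bounded by `W`, of which one averaging step produces at most
the multiple `7 / 6`; near the end there are more precise bounds. -/
structure HalfStart (S : Set ℕ) (W : ℕ → ℝ) (y : ℕ → ℝ) : Prop where
  mem : ∀ k < 44, k ∈ S
  avg : ∀ i, W i + W (i + 1) + W (i + 2) ≤ 7 / 2 * W (i + 1)
  small : ∀ i, 4 ≤ i → i + 1 ∈ S → W i ≤ 1 / 32
  le : ∀ i, i + 1 ∈ S → |y (i + 1) - y i - 1| ≤ W i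
  head : ∀ i < 20, |y (i + 1) - y i - 1| ≤ (1 / 2) ^ (6 + i)
  crude : ∀ i < 28, |y (i + 1) - y i - 1| ≤ 1 / 64

lemma cast_headTol {i : ℕ} (hi : i ≤ 20) :
    ((100 * 2 ^ (20 - i) : ℕ) : ℝ) = unit * (1 / 2) ^ (6 + i) := by
  have h2 : (2 : ℝ) ^ 20 = 2 ^ (20 - i) * 2 ^ i := by rw [← pow_add]; congr 1; omega
  rw [unit]
  push_cast
  rw [one_div, inv_pow, pow_add, eq_mul_inv_iff_mul_eq₀ (by positivity)]
  calc 100 * (2 : ℝ) ^ (20 - i) * (2 ^ 6 * 2 ^ i) = 100 * 2 ^ 6 * (2 ^ (20 - i) * 2 ^ i) := by ring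
    _ = _ := by rw [← h2]; norm_num

lemma HalfStart.encloses {S : Set ℕ} {W y : ℕ → ℝ} (h : HalfStart S W y) :
    Encloses unit openList y := by
  refine encloses_initList (fun i _ => ?_) fun i hi => ?_
  · rw [openTol, unit]
    split_ifs
    · exact Nat.mul_le_mul le_rfl (Nat.pow_le_pow_right (by norm_num) (by omega))
    · norm_num
  · rw [openTol, mul_comm]
    split_ifs with h20
    · rw [cast_headTol h20.le]
      exact mul_le_mul_of_nonneg_left (h.head i h20) (Nat.cast_nonneg _)
    · have := mul_le_mul_of_nonneg_left (h.crude i hi) (Nat.cast_nonneg unit)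
      norm_num [unit] at this ⊢
      linarith

/-- The bounds for the left end of many agents, `t` steps after the start of a period. -/
def openAt (t : ℕ) : List (ℕ × ℕ) := iterList false 0 openList t

lemma openAt_spec : (∀ t ≤ 8, (openAt t).length = 29 - 2 * t) ∧
    (∀ t < 8, gapsLe (tl t) (openAt t) = true ∧ gapsGe (th t) ((openAt t).drop 2) = true) ∧
    leftDetached (openAt 8) = true ∧
    ∀ i < 8, gapWithin (100 * 2 ^ (20 - i)) (i + 4) (openAt 8) = true := by
  obtain ⟨hc, hg⟩ := checkRun_spec openCheck_eq_true
  simp only [Bool.and_eq_true, zero_add, List.all_eq_true, List.mem_range] at hc hg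
  refine ⟨fun t ht => ?_, fun t ht => ⟨(hc t ht).1.2, (hc t ht).2⟩, hg.1.2, hg.2⟩
  rcases ht.lt_or_eq with h | rfl
  · exact Nat.eq_of_beq_eq_true (hc t h).1.1
  · exact Nat.eq_of_beq_eq_true hg.1.1

section Half

variable {θ : ℝ} {S : Set ℕ} {W : ℕ → ℝ} {Y : ℕ → ℕ → ℝ}

lemma HalfStart.encloses_openAt (hY : IsEvolution θ S Y) (h0 : HalfStart S W (Y 0))
    (h1 : 61 / 50 ≤ θ) (h2 : θ < 123 / 100) {t : ℕ} (ht : t ≤ 8) :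
    Encloses (unit * 420 ^ t) (openAt t) (Y t) :=
  Encloses.iterList (closed := false) hY h1 h2 (n := 8)
    (fun s hs k hk => h0.mem k (by
      change k < (openAt s).length at hk
      rw [openAt_spec.1 s hs.le] at hk
      omega)) (fun h => by simp at h) h0.encloses ht

/-- The gaps listed in `openAt` other than the first two exceed `θ / 2`. -/
lemma HalfStart.gap_of_open (hY : IsEvolution θ S Y) (h0 : HalfStart S W (Y 0))
    (h1 : 61 / 50 ≤ θ) (h2 : θ < 123 / 100) {t i : ℕ} (ht : t < 8) (hi : i + 1 < 29 - 2 * t) :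
    Y t (i + 1) - Y t i ≤ θ ∧ (2 ≤ i → θ / 2 < Y t (i + 1) - Y t i) := by
  have he := h0.encloses_openAt hY h1 h2 ht.le
  have hl := openAt_spec.1 t ht.le
  obtain ⟨ha, hb⟩ := openAt_spec.2.1 t ht
  refine ⟨he.le_of_hi h1 (by omega) (by omega) (gapsLe_spec ha (by omega)), fun hi2 => ?_⟩
  have h3 := gapsGe_spec hb (k := i - 2) (by rw [List.length_drop]; omega)
  have hd : ∀ k, lo ((openAt t).drop 2) k = lo (openAt t) (2 + k) := by
    intro k
    simp [lo, List.getD]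
  rw [hd, hd, show 2 + (i - 2 + 1) = i + 1 by omega, show 2 + (i - 2) = i by omega] at h3
  have h4 : 2 * (lo (openAt t) i : ℝ) + th t ≤ 2 * lo (openAt t) (i + 1) := by exact_mod_cast h3
  have h5 := (he i (i + 1) (by omega) (by omega)).1
  have h6 := lt_th h2 t
  exact lt_of_mul_lt_mul_left (by linarith) (scale_pos t).le

lemma isWindow_interior {x : ℕ → ℝ} {i : ℕ} (hS : ∀ i j, i ≤ j → j ∈ S → i ∈ S)
    (hx : ∀ i j, i ≤ j → j ∈ S → x i ≤ x j) (hi : i + 3 ∈ S)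
    (hg : ∀ k, i ≤ k → k ≤ i + 3 → k + 1 ∈ S → x (k + 1) - x k ≤ θ ∧ θ / 2 < x (k + 1) - x k) :
    IsWindow θ S x (i + 2) (i + 1) (i + 3) := by
  have g0 := hg i (by omega) (by omega) (hS _ _ (by omega) hi)
  have g1 := hg (i + 1) (by omega) (by omega) (hS _ _ (by omega) hi)
  have g2 := hg (i + 2) (by omega) (by omega) hi
  refine isWindow_of_mono hS hx (by omega) (by omega) hi (by linarith) (by linarith) ?_ ?_
  · intro c hc
    obtain rfl : c = i := by omega
    linarith
  · intro h
    have g3 := hg (i + 3) (by omega) (by omega) h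
    linarith

lemma windowMean_three (x : ℕ → ℝ) (i : ℕ) :
    windowMean x i (i + 2) = (x i + x (i + 1) + x (i + 2)) / 3 := by
  rw [windowMean, Finset.sum_Icc_succ_top (by omega), Finset.sum_Icc_succ_top (by omega),
    Finset.Icc_self, Finset.sum_singleton]
  congr 1
  push_cast
  ring

lemma pow_le_four {t : ℕ} (ht : t ≤ 8) : (7 / 6 : ℝ) ^ t ≤ 4 :=
  (pow_le_pow_right₀ (by norm_num) ht).trans (by norm_num)

lemma HalfStart.abs_le_of_le_pow {t i : ℕ} {u : ℝ} (h0 : HalfStart S W (Y 0)) (ht : t ≤ 8)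
    (hi : 4 ≤ i) (hiS : i + 1 ∈ S) (hu : |u| ≤ (7 / 6) ^ t * W i) : |u| ≤ 1 / 8 := by
  have hW := h0.small i hi hiS
  have hW0 : 0 ≤ W i := (abs_nonneg _).trans (h0.le i hiS)
  have := pow_le_four ht
  nlinarith

lemma HalfStart.gap_of_interior (hY : IsEvolution θ S Y) (h0 : HalfStart S W (Y 0))
    (h1 : 61 / 50 ≤ θ) (h2 : θ < 123 / 100) {t : ℕ} (ht : t < 8)
    (hint : ∀ i, 4 + t ≤ i → i + 2 * t + 6 ∈ S →
      |Y t (i + 1) - Y t i - 1| ≤ (7 / 6) ^ t * W i) {i : ℕ} (hi : i + 2 * t + 6 ∈ S) :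
    Y t (i + 1) - Y t i ≤ θ ∧ (2 ≤ i → θ / 2 < Y t (i + 1) - Y t i) := by
  rcases Nat.lt_or_ge (i + 1) (29 - 2 * t) with hlt | hge
  · exact h0.gap_of_open hY h1 h2 ht hlt
  · have := abs_le.1 (h0.abs_le_of_le_pow ht.le (by omega) (hY.lower _ _ (by omega) hi)
      (hint i (by omega) hi))
    constructor
    · linarith
    · intro _
      linarith

/-- Away from the end, where every agent has exactly its two nearest neighbours, a step replaces each
gap by the mean of three consecutive gaps, which multiplies the bounds by at most `7 / 6`. The
region in which this is known shrinks by one agent per step on the left, where it is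
complemented by the computed bounds `openAt`, and by two on the right. -/
theorem HalfStart.interior (hY : IsEvolution θ S Y) (h0 : HalfStart S W (Y 0))
    (h1 : 61 / 50 ≤ θ) (h2 : θ < 123 / 100) {t : ℕ} (ht : t ≤ 8) :
    ∀ i, 4 + t ≤ i → i + 2 * t + 6 ∈ S → |Y t (i + 1) - Y t i - 1| ≤ (7 / 6) ^ t * W i := by
  induction t with
  | zero =>
    intro i _ hi
    simpa using h0.le i (hY.lower _ _ (by omega) hi)
  | succ t ih =>
    intro i hi hiS
    have ih := ih (by omega)
    obtain ⟨k, rfl⟩ : ∃ k, i = k + 2 := ⟨i - 2, by omega⟩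
    have hg : ∀ l, k ≤ l → l ≤ k + 4 → Y t (l + 1) - Y t l ≤ θ ∧ θ / 2 < Y t (l + 1) - Y t l := by
      intro l hl hl'
      have := h0.gap_of_interior hY h1 h2 (by omega) ih (hY.lower (l + 2 * t + 6) _ (by omega) hiS)
      exact ⟨this.1, this.2 (by omega)⟩
    have w1 := isWindow_interior hY.lower (hY.mono t) (hY.lower (k + 3) _ (by omega) hiS)
      fun l hl hl' _ => hg l hl (by omega)
    have w2 := isWindow_interior hY.lower (hY.mono t) (hY.lower (k + 1 + 3) _ (by omega) hiS)
      fun l hl hl' _ => hg l (by omega) (by omega)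
    have e1 := hY.update t (k + 2) (hY.lower _ _ (by omega) hiS) _ _ w1
    have e2 := hY.update t (k + 3) (hY.lower _ _ (by omega) hiS) _ _ w2
    rw [show k + 3 = k + 1 + 2 by omega, windowMean_three] at e1
    rw [show k + 1 + 3 = k + 1 + 1 + 2 by omega, windowMean_three] at e2
    have b1 := ih (k + 1) (by omega) (hY.lower _ _ (by omega) hiS)
    have b2 := ih (k + 2) (by omega) (hY.lower _ _ (by omega) hiS)
    have b3 := ih (k + 3) (by omega) (hY.lower _ _ (by omega) hiS)
    have ha := h0.avg (k + 1)
    have hp : (0 : ℝ) < (7 / 6) ^ t := by positivity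
    have hm := mul_le_mul_of_nonneg_left ha hp.le
    rw [show k + 2 + 1 = k + 3 by omega, e1, e2, pow_succ]
    rw [abs_le] at b1 b2 b3 ⊢
    simp only [show k + 1 + 1 = k + 2 by omega, show k + 1 + 2 = k + 3 by omega,
      show k + 2 + 2 = k + 4 by omega] at *
    constructor <;> linarith [b1.1, b1.2, b2.1, b2.2, b3.1, b3.2]

lemma HalfStart.connected (hY : IsEvolution θ S Y) (h0 : HalfStart S W (Y 0))
    (h1 : 61 / 50 ≤ θ) (h2 : θ < 123 / 100) {t i : ℕ} (ht : t < 8) (hi : i + 2 * t + 6 ∈ S) :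
    Y t (i + 1) - Y t i ≤ θ :=
  (h0.gap_of_interior hY h1 h2 ht (h0.interior hY h1 h2 ht.le) hi).1

lemma HalfStart.frontDetached (hY : IsEvolution θ S Y) (h0 : HalfStart S W (Y 0))
    (h1 : 61 / 50 ≤ θ) (h2 : θ < 123 / 100) : FrontDetached θ (Y 8) :=
  frontDetached_of_encloses (h0.encloses_openAt hY h1 h2 le_rfl) h1 h2
    (by rw [openAt_spec.1 8 le_rfl]; norm_num) openAt_spec.2.2.1

/-- At the end of a period the gaps behind the detached group satisfy the bounds for the start of
the next one. -/
lemma HalfStart.head_eight (hY : IsEvolution θ S Y) (h0 : HalfStart S W (Y 0))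
    (h1 : 61 / 50 ≤ θ) (h2 : θ < 123 / 100) {i : ℕ}
    (hi : 8 ≤ i → i + 26 ∈ S ∧ W (i + 4) ≤ 2 * (1 / 2) ^ (10 + i)) :
    |Y 8 (4 + (i + 1)) - Y 8 (4 + i) - 1| ≤ (1 / 2) ^ (6 + i) := by
  rw [show 4 + (i + 1) = i + 4 + 1 by omega, show 4 + i = i + 4 by omega]
  rcases Nat.lt_or_ge i 8 with hlt | hge
  · refine (h0.encloses_openAt hY h1 h2 le_rfl).within ?_ ?_ (cast_headTol (by omega)).le
      (openAt_spec.2.2.2 i hlt)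
    · rw [openAt_spec.1 8 le_rfl]
      omega
    · rw [unit]
      exact Nat.mul_le_mul le_rfl (Nat.pow_le_pow_right (by norm_num) (by omega))
  · obtain ⟨hS, hW⟩ := hi hge
    refine (h0.interior hY h1 h2 le_rfl (i + 4) (by omega) hS).trans ?_
    have e : (1 / 2 : ℝ) ^ (10 + i) = (1 / 2) ^ (6 + i) / 16 := by
      rw [show 10 + i = 6 + i + 4 by omega, pow_add]
      norm_num
      ring
    have hp : (0 : ℝ) < (1 / 2) ^ (6 + i) := by positivity
    have := pow_le_four (le_refl 8)
    rw [e] at hW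
    calc (7 / 6 : ℝ) ^ 8 * W (i + 4) ≤ (7 / 6) ^ 8 * (2 * ((1 / 2) ^ (6 + i) / 16)) :=
          mul_le_mul_of_nonneg_left hW (by positivity)
      _ ≤ 4 * (2 * ((1 / 2) ^ (6 + i) / 16)) := mul_le_mul_of_nonneg_right this (by positivity)
      _ ≤ _ := by linarith

end Half

/-- For `m` agents the bound `W` superposes the contributions of the two ends. The second one,
`2 ^ i * (1 / 2) ^ (m + 4)`, is the mirror image `(1 / 2) ^ (6 + (m - 2 - i))` of the first, written
without truncated subtraction. -/
lemma halfStart_of_balanced {m : ℕ} {y : ℕ → ℝ} (hm : 44 ≤ m) (h : Balanced m y) :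
    HalfStart (Set.Iio m) (fun i => (1 / 2) ^ (6 + i) + 2 ^ i * (1 / 2) ^ (m + 4)) y := by
  have htol : ∀ i, tol m i = (1 / 2) ^ (6 + min i (m - 2 - i)) := fun i => by
    rw [tol, if_neg (by omega)]
  have hmirror : ∀ i, i + 2 ≤ m → (2 : ℝ) ^ i * (1 / 2) ^ (m + 4) = (1 / 2) ^ (6 + (m - 2 - i)) := by
    intro i hi
    rw [show m + 4 = i + (6 + (m - 2 - i)) by omega, pow_add, ← mul_assoc, ← mul_pow]
    norm_num
  constructor
  · intro k hk
    exact Set.mem_Iio.2 (by omega)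
  · intro i
    have e1 : (1 / 2 : ℝ) ^ (6 + i) = 4 * (1 / 2) ^ (6 + (i + 2)) := by
      rw [show 6 + (i + 2) = 6 + i + 2 by omega, pow_add _ (6 + i) 2]; ring
    have e2 : (1 / 2 : ℝ) ^ (6 + (i + 1)) = 2 * (1 / 2) ^ (6 + (i + 2)) := by
      rw [show 6 + (i + 2) = 6 + (i + 1) + 1 by omega, pow_add _ (6 + (i + 1)) 1]; ring
    have e3 : (2 : ℝ) ^ (i + 1) = 2 * 2 ^ i := by ring
    have e4 : (2 : ℝ) ^ (i + 2) = 4 * 2 ^ i := by ring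
    rw [e1, e2, e3, e4]
    generalize (1 / 2 : ℝ) ^ (m + 4) = q
    linarith
  · intro i hi hiS
    have hiS : i + 1 < m := hiS
    rw [hmirror i (by omega)]
    have h1 : (1 / 2 : ℝ) ^ (6 + i) ≤ (1 / 2) ^ 10 :=
      pow_le_pow_of_le_one (by norm_num) (by norm_num) (by omega)
    have h2 : (1 / 2 : ℝ) ^ (6 + (m - 2 - i)) ≤ (1 / 2) ^ 6 :=
      pow_le_pow_of_le_one (by norm_num) (by norm_num) (by omega)
    norm_num at h1 h2 ⊢
    linarith
  · intro i hiS
    have hiS : i + 1 < m := hiS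
    refine (h i hiS).trans ?_
    rw [hmirror i (by omega), htol]
    have p1 : (0 : ℝ) < (1 / 2) ^ (6 + i) := by positivity
    have p2 : (0 : ℝ) < (1 / 2) ^ (6 + (m - 2 - i)) := by positivity
    rcases min_choice i (m - 2 - i) with e | e <;> rw [e] <;> linarith
  · intro i hi
    refine (h i (by omega)).trans ?_
    rw [htol, min_eq_left (by omega)]
  · intro i hi
    refine (h i (by omega)).trans ?_
    rw [htol]
    refine (pow_le_pow_of_le_one (by norm_num) (by norm_num) (Nat.le_add_right 6 _)).trans ?_
    norm_num

lemma Balanced.reflect {m : ℕ} {y : ℕ → ℝ} (h : Balanced m y) :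
    Balanced m (fun i => -y (m - 1 - i)) := by
  intro i hi
  have := h (m - 2 - i) (by omega)
  have e : tol m (m - 2 - i) = tol m i := by
    rw [tol, tol, min_comm, show m - 2 - (m - 2 - i) = i by omega]
  rw [e, show m - 2 - i + 1 = m - 1 - i by omega] at this
  show |-y (m - 1 - (i + 1)) - -y (m - 1 - i) - 1| ≤ _
  rw [show m - 1 - (i + 1) = m - 2 - i by omega]
  rwa [show -y (m - 2 - i) - -y (m - 1 - i) - 1 = y (m - 1 - i) - y (m - 2 - i) - 1 by ring]

/-- Each half of the configuration is controlled from its own end; in the middle the growth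
`2 * (7 / 6) ^ 8 ≤ 8` of the bounds is outweighed by the factor `16` gained because the end has moved
by four agents. -/
theorem periodOK_of_ge {θ : ℝ} {m : ℕ} {Y : ℕ → ℕ → ℝ} (hY : IsEvolution θ (Set.Iio m) Y)
    (h1 : 61 / 50 ≤ θ) (h2 : θ < 123 / 100) (hm : 44 ≤ m) (h0 : Balanced m (Y 0)) :
    PeriodOK θ m Y := by
  have hl := halfStart_of_balanced hm h0
  have hr := halfStart_of_balanced hm h0.reflect
  have hY' := hY.reflect
  have hmid : ∀ i, 2 * i + 10 ≤ m → (1 / 2 : ℝ) ^ (6 + (i + 4)) + 2 ^ (i + 4) * (1 / 2) ^ (m + 4) ≤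
      2 * (1 / 2) ^ (10 + i) := by
    intro i hi
    have e : (2 : ℝ) ^ (i + 4) * (1 / 2) ^ (m + 4) = (1 / 2) ^ (m - i) := by
      rw [show m + 4 = (i + 4) + (m - i) by omega, pow_add _ (i + 4) (m - i), ← mul_assoc,
        ← mul_pow]
      norm_num
    have h3 : (1 / 2 : ℝ) ^ (m - i) ≤ (1 / 2) ^ (10 + i) :=
      pow_le_pow_of_le_one (by norm_num) (by norm_num) (by omega)
    rw [e, show 6 + (i + 4) = 10 + i by omega]
    linarith
  refine ⟨?_, hl.frontDetached hY h1 h2, hr.frontDetached hY' h1 h2, ?_⟩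
  · intro t ht i hi
    rcases Nat.lt_or_ge (i + 2 * t + 6) m with hlt | hge
    · exact hl.connected hY h1 h2 ht hlt
    · have := hr.connected hY' h1 h2 (i := m - 2 - i) ht (Set.mem_Iio.2 (by omega))
      rw [show m - 1 - (m - 2 - i + 1) = i by omega, show m - 1 - (m - 2 - i) = i + 1 by omega]
        at this
      linarith
  · intro i hi
    rw [tol, if_neg (by omega)]
    rcases Nat.le_total i (m - 8 - 2 - i) with hle | hle
    · rw [min_eq_left hle]
      exact hl.head_eight hY h1 h2 fun h8 => ⟨Set.mem_Iio.2 (by omega), hmid i (by omega)⟩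
    · rw [min_eq_right hle]
      have := hr.head_eight hY' h1 h2 (i := m - 8 - 2 - i) fun h8 =>
        ⟨Set.mem_Iio.2 (by omega), hmid _ (by omega)⟩
      beta_reduce at this
      rw [show m - 1 - (4 + (m - 8 - 2 - i + 1)) = 4 + i by omega,
        show m - 1 - (4 + (m - 8 - 2 - i)) = 4 + (i + 1) by omega] at this
      show |Y 8 (4 + (i + 1)) - Y 8 (4 + i) - 1| ≤ _
      rwa [show Y 8 (4 + (i + 1)) - Y 8 (4 + i) - 1 = -Y 8 (4 + i) - -Y 8 (4 + (i + 1)) - 1 by ring]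

theorem periodOK {θ : ℝ} {m : ℕ} {Y : ℕ → ℕ → ℝ} (hY : IsEvolution θ (Set.Iio m) Y)
    (h1 : 61 / 50 ≤ θ) (h2 : θ < 123 / 100) (hm : 8 ≤ m) (h0 : Balanced m (Y 0)) :
    PeriodOK θ m Y := by
  rcases Nat.lt_or_ge m 44 with h | h
  · exact periodOK_of_lt hY h1 h2 hm h h0
  · exact periodOK_of_ge hY h1 h2 h h0

/-! ### Succession of periods -/

/-- During the first `k` periods, a group of four agents detaches on the left at the end of each
period. -/
def Sheds (θ : ℝ) (S : Set ℕ) (X : ℕ → ℕ → ℝ) (k : ℕ) : Prop :=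
  ∀ j < k, 4 * j + 4 ∈ S ∧ FrontDetached θ (fun i => X (8 * (j + 1)) (4 * j + i))

section Finite

variable {θ : ℝ} {n : ℕ} {X : ℕ → ℕ → ℝ}

lemma balanced_of_gap_eq_one {m : ℕ} {y : ℕ → ℝ} (h : ∀ i, i + 1 < m → y (i + 1) - y i = 1) :
    Balanced m y := by
  intro i hi
  rw [h i hi, sub_self, abs_zero, tol]
  split_ifs <;> positivity

/-- After `j` periods the agents in the middle form an evolution of their own, starting from
nearly equal spacing. -/
theorem middle_evolution (hX : IsEvolution θ (Set.Iio n) X) (h1 : 61 / 50 ≤ θ)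
    (h2 : θ < 123 / 100) (h0 : ∀ i, i + 1 < n → X 0 (i + 1) - X 0 i = 1) {j : ℕ}
    (hj : 8 * j ≤ n) :
    IsEvolution θ (Set.Iio (n - 8 * j)) (fun t i => X (8 * j + t) (4 * j + i)) ∧
      Balanced (n - 8 * j) (fun i => X (8 * j) (4 * j + i)) := by
  induction j with
  | zero => simpa using ⟨hX, balanced_of_gap_eq_one h0⟩
  | succ j ih =>
    obtain ⟨hE, hB⟩ := ih (by omega)
    have hp := periodOK hE h1 h2 (by omega) hB
    have hb := hp.balanced
    have hE' := hE.block 8 4 (S' := Set.Iio (n - 8 * j - 8))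
      (fun i j hij hj => lt_of_le_of_lt hij hj)
      (fun i hi => by rw [Set.mem_Iio] at hi ⊢; omega)
      (fun s' hs' _ => by obtain rfl : s' = 3 := by omega
                          exact hp.left.gap)
      (fun i hi hi' _ => by
        rw [Set.mem_Iio] at hi hi'
        have := hp.right.gap
        rw [show n - 8 * j - 1 - 3 = 4 + i + 1 by omega,
          show n - 8 * j - 1 - 4 = 4 + i by omega] at this
        linarith)
    rw [show n - 8 * (j + 1) = n - 8 * j - 8 by omega]
    have e1 : ∀ t, 8 * j + 8 + t = 8 * j + (8 + t) := fun t => by omega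
    have e2 : ∀ i, 4 * (j + 1) + i = 4 * j + (4 + i) := fun i => by omega
    simp only [e1, e2, show 8 * (j + 1) = 8 * j + 8 by omega]
    exact ⟨hE', hb⟩

lemma period_fin (hX : IsEvolution θ (Set.Iio n) X) (h1 : 61 / 50 ≤ θ) (h2 : θ < 123 / 100)
    (h0 : ∀ i, i + 1 < n → X 0 (i + 1) - X 0 i = 1) {j : ℕ} (hj : 8 * (j + 1) ≤ n) :
    PeriodOK θ (n - 8 * j) (fun t i => X (8 * j + t) (4 * j + i)) := by
  obtain ⟨hE, hB⟩ := middle_evolution hX h1 h2 h0 (show 8 * j ≤ n by omega)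
  exact periodOK hE h1 h2 (by omega) hB

lemma sheds_fin (hX : IsEvolution θ (Set.Iio n) X) (h1 : 61 / 50 ≤ θ) (h2 : θ < 123 / 100)
    (h0 : ∀ i, i + 1 < n → X 0 (i + 1) - X 0 i = 1) {k : ℕ} (hk : 8 * k ≤ n) :
    Sheds θ (Set.Iio n) X k := fun j hj =>
  ⟨Set.mem_Iio.2 (by omega), (period_fin hX h1 h2 h0 (show 8 * (j + 1) ≤ n by omega)).left⟩

lemma connected_fin (hX : IsEvolution θ (Set.Iio n) X) (h1 : 61 / 50 ≤ θ) (h2 : θ < 123 / 100)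
    (h0 : ∀ i, i + 1 < n → X 0 (i + 1) - X 0 i = 1) {j t i : ℕ} (hj : 8 * (j + 1) ≤ n)
    (ht : 8 * j ≤ t) (ht' : t < 8 * (j + 1)) (hi : 4 * j ≤ i) (hi' : i + 1 + 4 * j < n) :
    X t (i + 1) - X t i ≤ θ := by
  have := (period_fin hX h1 h2 h0 hj).connected (t - 8 * j) (by omega) (i - 4 * j) (by omega)
  rwa [show 8 * j + (t - 8 * j) = t by omega, show 4 * j + (i - 4 * j + 1) = i + 1 by omega,
    show 4 * j + (i - 4 * j) = i by omega] at this

end Finite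

/-- The gaps of the infinite system equal `1` up to a geometrically decaying tolerance, as they do at
the start of each period. -/
def BalancedInf (y : ℕ → ℝ) : Prop := ∀ i, |y (i + 1) - y i - 1| ≤ (1 / 2) ^ (6 + i)

lemma BalancedInf.halfStart {y : ℕ → ℝ} (h : BalancedInf y) :
    HalfStart Set.univ (fun i => (1 / 2) ^ (6 + i)) y where
  mem _ _ := Set.mem_univ _
  avg i := by
    have e1 : (1 / 2 : ℝ) ^ (6 + i) = 4 * (1 / 2) ^ (6 + (i + 2)) := by
      rw [show 6 + (i + 2) = 6 + i + 2 by omega, pow_add _ (6 + i) 2]; ring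
    have e2 : (1 / 2 : ℝ) ^ (6 + (i + 1)) = 2 * (1 / 2) ^ (6 + (i + 2)) := by
      rw [show 6 + (i + 2) = 6 + (i + 1) + 1 by omega, pow_add _ (6 + (i + 1)) 1]; ring
    rw [e1, e2]
    linarith
  small i hi _ := (pow_le_pow_of_le_one (by norm_num) (by norm_num)
    (show 5 ≤ 6 + i by omega)).trans (by norm_num)
  le i _ := h i
  head i _ := h i
  crude i _ := (h i).trans ((pow_le_pow_of_le_one (by norm_num) (by norm_num)
    (Nat.le_add_right 6 i)).trans (by norm_num))

section Infinite

variable {θ : ℝ} {X : ℕ → ℕ → ℝ}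

theorem rest_evolution (hX : IsEvolution θ Set.univ X) (h1 : 61 / 50 ≤ θ)
    (h2 : θ < 123 / 100) (h0 : ∀ i, X 0 (i + 1) - X 0 i = 1) (j : ℕ) :
    IsEvolution θ Set.univ (fun t i => X (8 * j + t) (4 * j + i)) ∧
      BalancedInf (fun i => X (8 * j) (4 * j + i)) := by
  induction j with
  | zero =>
    refine ⟨by simpa using hX, fun i => ?_⟩
    have := h0 i
    simp only [mul_zero, zero_add, this, sub_self, abs_zero]
    positivity
  | succ j ih =>
    obtain ⟨hE, hB⟩ := ih
    have hs := hB.halfStart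
    have hE' := hE.block 8 4 (S' := Set.univ) (fun _ _ _ _ => Set.mem_univ _)
      (fun _ _ => Set.mem_univ _)
      (fun s' hs' _ => by obtain rfl : s' = 3 := by omega
                          exact (hs.frontDetached hE h1 h2).gap)
      (fun i _ hi _ => absurd (Set.mem_univ _) hi)
    have e1 : ∀ t, 8 * j + 8 + t = 8 * j + (8 + t) := fun t => by omega
    have e2 : ∀ i, 4 * (j + 1) + i = 4 * j + (4 + i) := fun i => by omega
    simp only [e1, e2, show 8 * (j + 1) = 8 * j + 8 by omega]
    refine ⟨hE', fun i => ?_⟩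
    refine hs.head_eight hE h1 h2 fun _ => ⟨Set.mem_univ _, ?_⟩
    rw [show 6 + (i + 4) = 10 + i by omega]
    have : (0 : ℝ) < (1 / 2) ^ (10 + i) := by positivity
    linarith

lemma sheds_inf (hX : IsEvolution θ Set.univ X) (h1 : 61 / 50 ≤ θ) (h2 : θ < 123 / 100)
    (h0 : ∀ i, X 0 (i + 1) - X 0 i = 1) (k : ℕ) : Sheds θ Set.univ X k := fun j _ => by
  obtain ⟨hE, hB⟩ := rest_evolution hX h1 h2 h0 j
  exact ⟨Set.mem_univ _, hB.halfStart.frontDetached hE h1 h2⟩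

lemma connected_inf (hX : IsEvolution θ Set.univ X) (h1 : 61 / 50 ≤ θ) (h2 : θ < 123 / 100)
    (h0 : ∀ i, X 0 (i + 1) - X 0 i = 1) {j t i : ℕ}
    (ht : 8 * j ≤ t) (ht' : t < 8 * (j + 1)) (hi : 4 * j ≤ i) : X t (i + 1) - X t i ≤ θ := by
  obtain ⟨hE, hB⟩ := rest_evolution hX h1 h2 h0 j
  have := hB.halfStart.connected hE h1 h2 (t := t - 8 * j) (i := i - 4 * j) (by omega)
    (Set.mem_univ _)
  rwa [show 8 * j + (t - 8 * j) = t by omega, show 4 * j + (i - 4 * j + 1) = i + 1 by omega,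
    show 4 * j + (i - 4 * j) = i by omega] at this

/-- The neighbours of an agent during a period do not depend on the (nearly equally spaced)
configuration at the start of the period. -/
lemma exists_window_balancedInf (h1 : 61 / 50 ≤ θ) (h2 : θ < 123 / 100) {t : ℕ} (ht : t < 8)
    (i : ℕ) : ∃ a b, ∀ Y : ℕ → ℕ → ℝ, IsEvolution θ Set.univ Y → BalancedInf (Y 0) →
      IsWindow θ Set.univ (Y t) i a b := by
  have hlen : (openAt (t + 1)).length = 29 - 2 * (t + 1) := openAt_spec.1 _ (by omega)
  have hstep : openAt (t + 1) = stepList false (tl t) (th t) [] (openAt t) := by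
    rw [openAt, iterList, zero_add, openAt]
  rcases Nat.lt_or_ge i (openAt (t + 1)).length with hlt | hge
  · rw [hstep] at hlt
    obtain ⟨a, b, h⟩ := exists_rowCert hlt
    refine ⟨a, b, fun Y hY h0 => ?_⟩
    exact h.isWindow (scale_pos t) (tl_le h1 t) (lt_th h2 t) hY.lower (hY.mono t)
      (fun _ _ => Set.mem_univ _) (fun h => by simp at h)
      (h0.halfStart.encloses_openAt hY h1 h2 ht.le)
  · obtain ⟨k, rfl⟩ : ∃ k, i = k + 2 := ⟨i - 2, by omega⟩
    refine ⟨k + 1, k + 3, fun Y hY h0 => ?_⟩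
    have hs := h0.halfStart
    refine isWindow_interior hY.lower (hY.mono t) (Set.mem_univ _) fun l hl _ _ => ?_
    have := hs.gap_of_interior hY h1 h2 ht (hs.interior hY h1 h2 ht.le) (i := l) (Set.mem_univ _)
    exact ⟨this.1, this.2 (by omega)⟩

end Infinite

/-! ### Detached groups -/

namespace Sheds

variable {θ : ℝ} {S : Set ℕ} {X : ℕ → ℕ → ℝ} {k : ℕ}

lemma gap (hX : IsEvolution θ S X) (h : Sheds θ S X k) {j t : ℕ} (hj : j < k)
    (ht : 8 * (j + 1) ≤ t) : θ < X t (4 * j + 4) - X t (4 * j + 3) :=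
  hX.gap_of_le ht (h j hj).1 (h j hj).2.gap

lemma gap_before (hX : IsEvolution θ S X) (h : Sheds θ S X k) {j t c : ℕ} (hj : j ≤ k)
    (ht : 8 * j ≤ t) (hc : c + 1 = 4 * j) : θ < X t (c + 1) - X t c := by
  have := h.gap hX (j := j - 1) (t := t) (by omega) (by omega)
  rwa [show 4 * (j - 1) + 4 = c + 1 by omega, show 4 * (j - 1) + 3 = c by omega] at this

lemma eq_of_lt (hX : IsEvolution θ S X) (hθ : 0 ≤ θ) (h : Sheds θ S X k) {j t : ℕ} (hj : j < k)
    (ht : 8 * (j + 1) + 1 ≤ t) : X t (4 * j) = X t (4 * j + 3) := by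
  obtain ⟨hS, hF⟩ := h j hj
  have h3 : 4 * j + 3 ∈ S := hX.lower _ _ (by omega) hS
  refine hX.eq_of_le hθ ht (hX.lower _ _ (by omega) hS) h3 ?_
  exact hX.collapse (by omega) h3 hF.span
    (fun c hc => by rw [← hc]; exact h.gap_before hX hj.le (by omega) hc) (fun _ => hF.gap)

/-- In a detached group any two agents are neighbours. -/
lemma span (hX : IsEvolution θ S X) (hθ : 0 ≤ θ) (h : Sheds θ S X k) {j t : ℕ} (hj : j < k)
    (ht : 8 * (j + 1) ≤ t) : X t (4 * j + 3) - X t (4 * j) ≤ θ := by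
  rcases ht.eq_or_lt with rfl | hlt
  · exact (h j hj).2.span
  · rw [h.eq_of_lt hX hθ hj hlt, sub_self]
    exact hθ

end Sheds
/-! ### Components and clusters in terms of gaps -/

/-- The evolution `x` of agents of any type is described by the evolution `X` of the agents in `S`,
agent `i` being numbered `f i`. -/
structure Realizes {ι : Type*} (θ : ℝ) (S : Set ℕ) (f : ι → ℕ) (x : ℕ → ι → ℝ)
    (X : ℕ → ℕ → ℝ) : Prop where
  inj : Function.Injective f
  mem_iff : ∀ k, k ∈ S ↔ ∃ i, f i = k
  near_iff : ∀ t i i', |x t i - x t i'| ≤ 1 ↔ |X t (f i) - X t (f i')| ≤ θ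
  eq_iff : ∀ t i i', x t i = x t i' ↔ X t (f i) = X t (f i')

/-- The set `T` of numbers is an interval of agents whose border gaps exceed `θ`. -/
structure Separated (θ : ℝ) (S T : Set ℕ) (y : ℕ → ℝ) : Prop where
  sub : T ⊆ S
  nonempty : T.Nonempty
  ord : ∀ i j k, i ∈ T → k ∈ T → i ≤ j → j ≤ k → j ∈ T
  border : ∀ k, k + 1 ∈ S → ¬(k ∈ T ↔ k + 1 ∈ T) → θ < y (k + 1) - y k

section Translate

variable {ι : Type*} {θ : ℝ} {S T : Set ℕ} {f : ι → ℕ} {x : ℕ → ι → ℝ} {X : ℕ → ℕ → ℝ}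

lemma Separated.lt_of_le (hX : IsEvolution θ S X) {t : ℕ} (hT : Separated θ S T (X t)) {k l : ℕ}
    (hkl : k ≤ l) (hl : l ∈ S) (h : ¬(k ∈ T ↔ l ∈ T)) : θ < X t l - X t k := by
  induction l, hkl using Nat.le_induction with
  | base => exact absurd Iff.rfl h
  | succ l hkl ih =>
    have hl' : l ∈ S := hX.lower _ _ (Nat.le_succ l) hl
    by_cases hb : l ∈ T ↔ l + 1 ∈ T
    · have := ih hl' (by rwa [hb])
      linarith [hX.mono t l (l + 1) (Nat.le_succ l) hl]
    · have := hT.border l hl hb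
      linarith [hX.mono t k l hkl hl']

lemma Separated.lt (hX : IsEvolution θ S X) {t : ℕ} (hT : Separated θ S T (X t)) {k l : ℕ}
    (hk : k ∈ S) (hl : l ∈ S) (h : ¬(k ∈ T ↔ l ∈ T)) : θ < |X t k - X t l| := by
  rcases Nat.le_total k l with hkl | hkl
  · have := hT.lt_of_le hX hkl hl h
    rw [abs_sub_comm]
    exact this.trans_le (le_abs_self _)
  · exact (hT.lt_of_le hX hkl hk fun h' => h h'.symm).trans_le (le_abs_self _)

lemma Separated.isComponent (hX : IsEvolution θ S X) (hR : Realizes θ S f x X) {t : ℕ}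
    (hT : Separated θ S T (X t)) (hcon : ∀ k ∈ T, k + 1 ∈ T → X t (k + 1) - X t k ≤ θ) :
    IsComponent (x t) {i | f i ∈ T} := by
  obtain ⟨k₀, hk₀⟩ := hT.nonempty
  obtain ⟨i₀, rfl⟩ := (hR.mem_iff k₀).1 (hT.sub hk₀)
  have hreach : ∀ k l, k ≤ l → k ∈ T → l ∈ T → ∀ i i', f i = k → f i' = l →
      (receptivityGraph (x t)).Reachable i i' := by
    intro k l hkl
    induction l, hkl using Nat.le_induction with
    | base =>
      intro _ _ i i' hi hi'
      rw [hR.inj (hi.trans hi'.symm)]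
    | succ l hkl ih =>
      intro hk hl i i' hi hi'
      have hlT := hT.ord k l (l + 1) hk hl hkl (Nat.le_succ l)
      obtain ⟨i'', hi''⟩ := (hR.mem_iff l).1 (hT.sub hlT)
      refine (ih hk hlT i i'' hi hi'').trans (SimpleGraph.Adj.reachable ⟨?_, ?_⟩)
      · rintro rfl
        omega
      · rw [hR.near_iff, hi', hi'', abs_sub_comm,
          abs_of_nonneg (sub_nonneg.2 (hX.mono t _ _ (Nat.le_succ l) (hT.sub hl)))]
        exact hcon l hlT hl
  have hwalk : ∀ u v, (receptivityGraph (x t)).Walk u v → f v ∈ T → f u ∈ T := by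
    intro u v w
    induction w with
    | nil => exact id
    | @cons u v _ hadj _ ih =>
      intro h
      by_contra hu
      refine absurd ((hR.near_iff t u v).1 hadj.2) (not_le.2 ?_)
      exact hT.lt hX ((hR.mem_iff _).2 ⟨u, rfl⟩) ((hR.mem_iff _).2 ⟨v, rfl⟩) fun h' => hu (h'.2 (ih h))
  refine ⟨(receptivityGraph (x t)).connectedComponentMk i₀, ?_⟩
  ext i
  rw [SimpleGraph.ConnectedComponent.mem_supp_iff, SimpleGraph.ConnectedComponent.eq]
  constructor
  · rintro ⟨w⟩
    exact hwalk _ _ w hk₀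
  · intro hi
    rcases Nat.le_total (f i) (f i₀) with h | h
    · exact hreach _ _ h hi hk₀ _ _ rfl rfl
    · exact (hreach _ _ h hk₀ hi _ _ rfl rfl).symm

lemma Separated.isCluster (hX : IsEvolution θ S X) (hR : Realizes θ S f x X) (hθ : 0 ≤ θ) {t : ℕ}
    (hT : Separated θ S T (X t)) (heq : ∀ k ∈ T, ∀ l ∈ T, k ≤ l → X t k = X t l) :
    IsCluster (x t) {i | f i ∈ T} := by
  obtain ⟨k₀, hk₀⟩ := hT.nonempty
  obtain ⟨i₀, rfl⟩ := (hR.mem_iff k₀).1 (hT.sub hk₀)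
  refine ⟨i₀, ?_⟩
  ext i
  simp only [Set.mem_ofPred_eq]
  rw [hR.eq_iff]
  constructor
  · intro hi
    rcases Nat.le_total (f i) (f i₀) with h | h
    · exact heq _ hi _ hk₀ h
    · exact (heq _ hk₀ _ hi h).symm
  · intro h
    by_contra hi
    have := hT.lt hX ((hR.mem_iff (f i)).2 ⟨i, rfl⟩) (hT.sub hk₀)
      (fun h' => hi (h'.2 hk₀))
    rw [h, sub_self, abs_zero] at this
    linarith

lemma frozen_of_gaps (hR : Realizes θ S f x X) (hS : ∀ i j, i ≤ j → j ∈ S → i ∈ S) {t : ℕ}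
    (hmono : ∀ i j, i ≤ j → j ∈ S → X t i ≤ X t j)
    (h : ∀ k, k + 1 ∈ S → X t k = X t (k + 1) ∨ θ < X t (k + 1) - X t k) : Frozen (x t) := by
  have key : ∀ k l, k ≤ l → l ∈ S → X t k = X t l ∨ θ < X t l - X t k := by
    intro k l hkl
    induction l, hkl using Nat.le_induction with
    | base => exact fun _ => Or.inl rfl
    | succ l hkl ih =>
      intro hl
      have h1 := ih (hS _ _ (Nat.le_succ l) hl)
      have h2 := hmono k l hkl (hS _ _ (Nat.le_succ l) hl)
      have h3 := hmono l (l + 1) (Nat.le_succ l) hl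
      rcases h l hl with h4 | h4
      · rwa [← h4]
      · right
        linarith
  intro i i' hne
  by_contra hle
  rw [Ne, hR.eq_iff] at hne
  rw [not_lt, hR.near_iff] at hle
  have hi := (hR.mem_iff (f i)).2 ⟨i, rfl⟩
  have hi' := (hR.mem_iff (f i')).2 ⟨i', rfl⟩
  rcases Nat.le_total (f i) (f i') with hl | hl
  · rcases key _ _ hl hi' with h1 | h1
    · exact hne h1
    · rw [abs_sub_comm] at hle
      linarith [le_abs_self (X t (f i') - X t (f i))]
  · rcases key _ _ hl hi with h1 | h1
    · exact hne h1.symm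
    · linarith [le_abs_self (X t (f i) - X t (f i'))]

lemma separated_group (hX : IsEvolution θ S X) {k : ℕ} (h : Sheds θ S X k) {j t : ℕ} (hj : j < k)
    (ht : 8 * (j + 1) ≤ t) : Separated θ S {i | 4 * j ≤ i ∧ i < 4 * (j + 1)} (X t) where
  sub := fun i hi => hX.lower i _ (by have := hi.2; omega) (h j hj).1
  nonempty := ⟨4 * j, le_rfl, by omega⟩
  ord := fun a b c ha hc hab hbc => ⟨ha.1.trans hab, hbc.trans_lt hc.2⟩
  border := by
    intro c _ hc
    simp only [Set.mem_ofPred_eq] at hc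
    rcases (by omega : c + 1 = 4 * j ∨ c = 4 * j + 3) with h1 | rfl
    · exact h.gap_before hX hj.le (by omega) h1
    · exact h.gap hX hj ht

/-- A group of four agents shed at the end of a period is a component from then on, and collapses
one step later. -/
theorem Sheds.detachesAt (hX : IsEvolution θ S X) (hR : Realizes θ S f x X) (hθ : 0 ≤ θ) {k : ℕ}
    (h : Sheds θ S X k) {j : ℕ} (hj : j < k) :
    DetachesAt x {i | 4 * j ≤ f i ∧ f i < 4 * (j + 1)} (8 * (j + 1)) := by
  have hmem : ∀ i, i < 4 * (j + 1) → i ∈ S := fun i hi => hX.lower i _ (by omega) (h j hj).1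
  refine ⟨fun t ht => ?_, ?_, fun t ht => ?_⟩
  · refine (separated_group hX h hj ht).isComponent hX hR fun c hc hc' => ?_
    have h1 := h.span hX hθ hj ht
    have h2 := hX.mono t (4 * j) c hc.1 (hmem _ hc.2)
    have h3 := hX.mono t (c + 1) (4 * j + 3) (by have := hc'.2; omega) (hmem _ (by omega))
    linarith
  · rintro ⟨i₀, hi₀⟩
    have key : ∀ c, 4 * j ≤ c → c < 4 * (j + 1) → X (8 * (j + 1)) c = X (8 * (j + 1)) (f i₀) := by
      intro c hc hc'
      obtain ⟨i, rfl⟩ := (hR.mem_iff c).1 (hmem c hc')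
      have : i ∈ {i | 4 * j ≤ f i ∧ f i < 4 * (j + 1)} := ⟨hc, hc'⟩
      rw [hi₀] at this
      exact (hR.eq_iff _ _ _).1 this
    have h1 := key (4 * j + 2) (by omega) (by omega)
    have h2 := key (4 * j + 3) (by omega) (by omega)
    have := (h j hj).2.spread
    linarith
  · refine (separated_group hX h hj (by omega)).isCluster hX hR hθ fun c hc l hl hcl => ?_
    have h1 := h.eq_of_lt hX hθ hj ht
    have h2 := hX.mono t (4 * j) c hc.1 (hmem _ hc.2)
    have h3 := hX.mono t l (4 * j + 3) (by have := hl.2; omega) (hmem _ (by omega))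
    have h4 := hX.mono t c l hcl (hmem _ hl.2)
    linarith

end Translate
/-! ### Evolutions from equally spaced opinions -/

section Existence

variable {ι : Type*}

/-- The evolution of the opinions `x₀`, divided by `d`, with agent `i` numbered `f i`; it is `0` at
numbers that no agent has. The division makes the initial gaps equal to `1` and the confidence
bound equal to `1 / d`. -/
noncomputable def scaled (d : ℝ) (f : ι → ℕ) (x₀ : ι → ℝ) (t k : ℕ) : ℝ :=
  open Classical in if h : ∃ i, f i = k then evolve x₀ t h.choose / d else 0

lemma scaled_apply {d : ℝ} {f : ι → ℕ} (hf : Function.Injective f) (x₀ : ι → ℝ) (t : ℕ) (i : ι) :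
    scaled d f x₀ t (f i) = evolve x₀ t i / d := by
  have h : ∃ i', f i' = f i := ⟨i, rfl⟩
  rw [scaled, dif_pos h, hf h.choose_spec]

lemma abs_div_sub_le {d a b : ℝ} (hd : 0 < d) : |a - b| ≤ 1 ↔ |a / d - b / d| ≤ 1 / d := by
  rw [← sub_div, abs_div, abs_of_pos hd, div_le_div_iff_of_pos_right hd]

lemma realizes_scaled {d : ℝ} (hd : 0 < d) {f : ι → ℕ} (hf : Function.Injective f) {S : Set ℕ}
    (hS : ∀ k, k ∈ S ↔ ∃ i, f i = k) (x₀ : ι → ℝ) :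
    Realizes (1 / d) S f (evolve x₀) (scaled d f x₀) where
  inj := hf
  mem_iff := hS
  near_iff t i i' := by
    rw [scaled_apply hf, scaled_apply hf]
    exact abs_div_sub_le hd
  eq_iff t i i' := by
    rw [scaled_apply hf, scaled_apply hf, div_left_inj' hd.ne']

lemma step_div_eq_windowMean {d : ℝ} (hd : 0 < d) {f : ι → ℕ} (hf : Function.Injective f)
    {S : Set ℕ} (hlow : ∀ i j, i ≤ j → j ∈ S → i ∈ S) (hS : ∀ k, k ∈ S ↔ ∃ i, f i = k)
    {x : ι → ℝ} {y : ℕ → ℝ} (hy : ∀ i, y (f i) = x i / d) {i : ι} {a b : ℕ}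
    (hw : IsWindow (1 / d) S y (f i) a b) : step x i / d = windowMean y a b := by
  have himg : f '' nbhd x i = ↑(Finset.Icc a b) := by
    ext k
    simp only [Set.mem_image, Finset.coe_Icc, Set.mem_Icc]
    constructor
    · rintro ⟨j, hj, rfl⟩
      refine (hw.near_iff (f j) ((hS _).2 ⟨j, rfl⟩)).1 ?_
      rw [hy, hy]
      exact (abs_div_sub_le hd).1 hj
    · intro hk
      have hkS := hlow _ _ hk.2 hw.right_mem
      obtain ⟨j, rfl⟩ := (hS k).1 hkS
      refine ⟨j, ?_, rfl⟩
      have := (hw.near_iff (f j) hkS).2 hk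
      rw [hy, hy] at this
      exact (abs_div_sub_le hd).2 this
  have hsum : ∑ᶠ j ∈ nbhd x i, x j = d * ∑ k ∈ Finset.Icc a b, y k := by
    rw [Finset.mul_sum, ← finsum_mem_coe_finset, ← himg, finsum_mem_image hf.injOn]
    refine finsum_mem_congr rfl fun j _ => ?_
    rw [hy, mul_div_cancel₀ _ hd.ne']
  have hcard : ((nbhd x i).ncard : ℝ) = (b : ℝ) + 1 - a := by
    rw [← Set.ncard_image_of_injective _ hf, himg, Set.ncard_coe_finset, Nat.card_Icc,
      Nat.cast_sub (by have := hw.left_le; have := hw.le_right; omega)]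
    push_cast
    ring
  rw [step, hsum, hcard, windowMean, div_div, mul_comm _ d, mul_div_mul_left _ _ hd.ne']

/-- The Hegselmann-Krause dynamics is an evolution in the abstract sense, provided that the
neighbourhoods are finite; this may be derived from a property `P` of the opinions that is
propagated in time. -/
lemma isEvolution_scaled {d : ℝ} (hd : 0 < d) {f : ι → ℕ} (hf : Function.Injective f)
    {S : Set ℕ} (hlow : ∀ i j, i ≤ j → j ∈ S → i ∈ S) (hS : ∀ k, k ∈ S ↔ ∃ i, f i = k)
    {x₀ : ι → ℝ} (hmono : ∀ i j, i ≤ j → j ∈ S → scaled d f x₀ 0 i ≤ scaled d f x₀ 0 j)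
    (P : ℕ → (ℕ → ℝ) → Prop) (h0 : P 0 (scaled d f x₀ 0))
    (hwin : ∀ t y, P t y → (∀ i j, i ≤ j → j ∈ S → y i ≤ y j) →
      ∀ i ∈ S, ∃ a b, IsWindow (1 / d) S y i a b)
    (hP : ∀ t y y', P t y → (∀ i j, i ≤ j → j ∈ S → y i ≤ y j) →
      (∀ i ∈ S, ∀ a b, IsWindow (1 / d) S y i a b → y' i = windowMean y a b) → P (t + 1) y') :
    IsEvolution (1 / d) S (scaled d f x₀) := by
  have hupd : ∀ t, ∀ i ∈ S, ∀ a b, IsWindow (1 / d) S (scaled d f x₀ t) i a b →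
      scaled d f x₀ (t + 1) i = windowMean (scaled d f x₀ t) a b := by
    intro t i hi a b hw
    obtain ⟨i, rfl⟩ := (hS i).1 hi
    rw [scaled_apply hf, evolve, Function.iterate_succ_apply']
    exact step_div_eq_windowMean hd hf hlow hS (scaled_apply hf x₀ t) hw
  have key : ∀ t, (∀ i j, i ≤ j → j ∈ S → scaled d f x₀ t i ≤ scaled d f x₀ t j) ∧
      P t (scaled d f x₀ t) := by
    intro t
    induction t with
    | zero => exact ⟨hmono, h0⟩
    | succ t ih =>
      exact ⟨mono_of_update hlow ih.1 (hwin t _ ih.2 ih.1) (hupd t), hP t _ _ ih.2 ih.1 (hupd t)⟩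
  exact ⟨hlow, fun t => (key t).1, fun t => hwin t _ (key t).2 (key t).1, hupd⟩

end Existence

lemma scaled_equalFin {d : ℝ} (hd : 0 < d) {n i : ℕ} (hi : i < n) :
    scaled d Fin.val (equalFin n d) 0 i = 1 / d + i := by
  have h := scaled_apply (d := d) Fin.val_injective (equalFin n d) 0 ⟨i, hi⟩
  change scaled d Fin.val (equalFin n d) 0 i = (1 + (i : ℝ) * d) / d at h
  rw [h]
  field_simp

lemma mem_Iio_iff_exists_fin {n : ℕ} (k : ℕ) : k ∈ Set.Iio n ↔ ∃ i : Fin n, (i : ℕ) = k :=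
  ⟨fun h => ⟨⟨k, h⟩, rfl⟩, fun ⟨i, hi⟩ => hi ▸ i.2⟩

lemma isEvolution_equalFin {d : ℝ} (hd : 0 < d) (n : ℕ) :
    IsEvolution (1 / d) (Set.Iio n) (scaled d Fin.val (equalFin n d)) := by
  refine isEvolution_scaled hd Fin.val_injective (fun i j hij hj => lt_of_le_of_lt hij hj)
    mem_Iio_iff_exists_fin (fun i j hij hj => ?_) (fun _ _ => True) trivial
    (fun t y _ hy i hi => ?_) (fun _ _ _ _ _ _ => trivial)
  · rw [scaled_equalFin hd (lt_of_le_of_lt hij hj), scaled_equalFin hd hj]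
    gcongr
  · exact exists_window_of_finite (fun i j hij hj => lt_of_le_of_lt hij hj) hy (by positivity) hi
      ((Set.finite_Iio n).subset fun j hj => hj.1)

lemma scaled_equalInf {d : ℝ} (hd : 0 < d) (i : ℕ) :
    scaled d id (equalInf d) 0 i = 1 / d + i := by
  have h := scaled_apply (d := d) Function.injective_id (equalInf d) 0 i
  change scaled d id (equalInf d) 0 i = (1 + (i : ℝ) * d) / d at h
  rw [h]
  field_simp

/-- In the infinite system the agents from `2 * t` on have not moved before time `t`, so that all
neighbourhoods are finite. -/
lemma isEvolution_equalInf {d : ℝ} (hd : 0 < d) (h1 : 1 ≤ 1 / d) (h2 : 1 / d < 2) :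
    IsEvolution (1 / d) Set.univ (scaled d id (equalInf d)) := by
  refine isEvolution_scaled hd Function.injective_id (fun _ _ _ _ => Set.mem_univ _)
    (fun k => ⟨fun _ => ⟨k, rfl⟩, fun _ => Set.mem_univ _⟩) (fun i j hij _ => ?_)
    (fun t y => ∀ i, 2 * t ≤ i → y i = 1 / d + i) (fun i _ => scaled_equalInf hd i)
    (fun t y hP hy i hi => ?_) (fun t y y' hP hy hu i hi => ?_)
  · rw [scaled_equalInf hd, scaled_equalInf hd]
    gcongr
  · refine exists_window_of_finite (fun _ _ _ _ => Set.mem_univ _) hy (by positivity) hi ?_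
    obtain ⟨R, hR⟩ := exists_nat_gt (y i)
    refine (Set.finite_Iio (max R (2 * t))).subset fun j hj => ?_
    by_contra hge
    have hge : max R (2 * t) ≤ j := not_lt.1 hge
    have h3 := hP j ((le_max_right _ _).trans hge)
    have h4 : (R : ℝ) ≤ j := by exact_mod_cast (le_max_left R (2 * t)).trans hge
    have h5 := (abs_le.1 hj.2).2
    linarith
  · obtain ⟨k, rfl⟩ : ∃ k, i = k + 2 := ⟨i - 2, by omega⟩
    have e : ∀ l, y (k + l) = 1 / d + k + l := fun l => by
      rw [hP (k + l) (by omega)]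
      push_cast
      ring
    have hw : IsWindow (1 / d) Set.univ y (k + 2) (k + 1) (k + 3) := by
      refine isWindow_of_mono (fun _ _ _ _ => Set.mem_univ _) hy (by omega) (by omega)
        (Set.mem_univ _) ?_ ?_ ?_ ?_
      · rw [e, e]; push_cast; linarith
      · rw [e, e]; push_cast; linarith
      · intro c hc
        have hck : c = k := by omega
        have e0 : y k = 1 / d + k := hP k (by omega)
        rw [hck, e, e0]; push_cast; linarith
      · intro _
        rw [show k + 3 + 1 = k + 4 by omega, e, e]; push_cast; linarith
    rw [hu _ (Set.mem_univ _) _ _ hw, show k + 3 = k + 1 + 2 by omega, windowMean_three,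
      show k + 1 + 1 = k + 2 by omega, show k + 1 + 2 = k + 3 by omega, e, e, e]
    push_cast
    ring

/-! ### The infinite system -/

lemma Sheds.near_iff {θ : ℝ} {S : Set ℕ} {X : ℕ → ℕ → ℝ} (hX : IsEvolution θ S X) (hθ : 0 ≤ θ)
    {k : ℕ} (h : Sheds θ S X k) {j t i l : ℕ} (hj : j < k) (ht : 8 * (j + 1) ≤ t)
    (hi : 4 * j ≤ i) (hi' : i < 4 * (j + 1)) (hl : l ∈ S) :
    |X t i - X t l| ≤ θ ↔ 4 * j ≤ l ∧ l < 4 * (j + 1) := by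
  have hmem : ∀ i, i < 4 * (j + 1) → i ∈ S := fun i hi => hX.lower i _ (by omega) (h j hj).1
  constructor
  · intro hle
    by_contra hnot
    have := (separated_group hX h hj ht).lt hX (hmem i hi') hl
      (fun h' => hnot (h'.1 ⟨hi, hi'⟩))
    linarith
  · intro hl'
    have h1 := h.span hX hθ hj ht
    have a1 := hX.mono t (4 * j) i hi (hmem _ hi')
    have a2 := hX.mono t i (4 * j + 3) (by omega) (hmem _ (by omega))
    have b1 := hX.mono t (4 * j) l hl'.1 (hmem _ hl'.2)
    have b2 := hX.mono t l (4 * j + 3) (by omega) (hmem _ (by omega))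
    rw [abs_le]
    constructor <;> linarith

/-- Eight steps shift the neighbourhoods in the infinite system by four agents. -/
theorem near_shift_iff {θ : ℝ} {X : ℕ → ℕ → ℝ} (hX : IsEvolution θ Set.univ X)
    (h1 : 61 / 50 ≤ θ) (h2 : θ < 123 / 100) (h0 : ∀ i, X 0 (i + 1) - X 0 i = 1) (t i l : ℕ) :
    |X (t + 8) (i + 4) - X (t + 8) (l + 4)| ≤ θ ↔ |X t i - X t l| ≤ θ := by
  have hθ : 0 ≤ θ := by linarith
  have hold : ∀ i l, i < 4 * (t / 8) →
      (|X (t + 8) (i + 4) - X (t + 8) (l + 4)| ≤ θ ↔ |X t i - X t l| ≤ θ) := by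
    intro i l hi
    rw [(sheds_inf hX h1 h2 h0 (i / 4 + 2)).near_iff hX hθ (j := i / 4 + 1) (by omega) (by omega)
      (by omega) (by omega) (Set.mem_univ _),
      (sheds_inf hX h1 h2 h0 (i / 4 + 1)).near_iff hX hθ (j := i / 4) (by omega) (by omega)
      (by omega) (by omega) (Set.mem_univ _)]
    omega
  rcases Nat.lt_or_ge i (4 * (t / 8)) with hi | hi
  · exact hold i l hi
  rcases Nat.lt_or_ge l (4 * (t / 8)) with hl | hl
  · rw [abs_sub_comm, hold l i hl, abs_sub_comm]
  obtain ⟨a, b, hab⟩ := exists_window_balancedInf h1 h2 (t := t % 8) (by omega) (l - 4 * (t / 8))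
  obtain ⟨hE, hB⟩ := rest_evolution hX h1 h2 h0 (t / 8)
  obtain ⟨hE', hB'⟩ := rest_evolution hX h1 h2 h0 (t / 8 + 1)
  have w := (hab _ hE hB).near_iff (i - 4 * (t / 8)) (Set.mem_univ _)
  have w' := (hab _ hE' hB').near_iff (i - 4 * (t / 8)) (Set.mem_univ _)
  rw [show 8 * (t / 8) + t % 8 = t by omega, show 4 * (t / 8) + (i - 4 * (t / 8)) = i by omega,
    show 4 * (t / 8) + (l - 4 * (t / 8)) = l by omega] at w
  rw [show 8 * (t / 8 + 1) + t % 8 = t + 8 by omega,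
    show 4 * (t / 8 + 1) + (i - 4 * (t / 8)) = i + 4 by omega,
    show 4 * (t / 8 + 1) + (l - 4 * (t / 8)) = l + 4 by omega] at w'
  rw [w, w']

theorem periodicInf_equalInf {d : ℝ} (hd : 0 < d) (h1 : 61 / 50 ≤ 1 / d) (h2 : 1 / d < 123 / 100) :
    PeriodicInf (evolve (equalInf d)) := by
  have hX := isEvolution_equalInf hd (by linarith) (by linarith)
  have hmem : ∀ k, k ∈ Set.univ ↔ ∃ i : ℕ, id i = k :=
    fun k => ⟨fun _ => ⟨k, rfl⟩, fun _ => Set.mem_univ _⟩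
  have hR := realizes_scaled hd Function.injective_id hmem (equalInf d)
  have h0 : ∀ i, scaled d id (equalInf d) 0 (i + 1) - scaled d id (equalInf d) 0 i = 1 := by
    intro i
    rw [scaled_equalInf hd, scaled_equalInf hd]
    push_cast
    ring
  refine ⟨fun t i => ?_, fun j t ht ht' => ?_, fun j => ?_, fun t i i' => ?_⟩
  · obtain ⟨a, b, hw⟩ := hX.exists_window t i (Set.mem_univ _)
    refine (Set.finite_Icc a b).subset fun j hj => ?_
    exact (hw.near_iff j (Set.mem_univ _)).1 ((hR.near_iff t j i).1 hj)
  · have hs := sheds_inf hX h1 h2 h0 j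
    have hsep : Separated (1 / d) Set.univ {i | 4 * j ≤ i} (scaled d id (equalInf d) t) :=
      ⟨Set.subset_univ _, ⟨4 * j, le_refl (4 * j)⟩, fun a b c ha _ hab _ => le_trans ha hab, by
        intro c _ hc
        simp only [Set.mem_ofPred_eq] at hc
        exact hs.gap_before hX le_rfl ht (by omega)⟩
    exact hsep.isComponent hX hR fun c hc _ => connected_inf hX h1 h2 h0 ht ht' hc
  · exact (sheds_inf hX h1 h2 h0 (j + 1)).detachesAt hX hR (by positivity) (by omega)
  · have hn := near_shift_iff hX h1 h2 h0 t i i'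
    have e1 := hR.near_iff (t + 8) (i + 4) (i' + 4)
    have e2 := hR.near_iff t i i'
    simp only [id] at e1 e2
    show (i + 4 ≠ i' + 4 ∧ _) ↔ (i ≠ i' ∧ _)
    rw [e1, e2, hn]
    simp

/-! ### The finite system -/

lemma Realizes.reflect {ι : Type*} {θ : ℝ} {n : ℕ} {f : ι → ℕ} {x : ℕ → ι → ℝ} {X : ℕ → ℕ → ℝ}
    (hR : Realizes θ (Set.Iio n) f x X) :
    Realizes θ (Set.Iio n) (fun i => n - 1 - f i) x (fun t i => -X t (n - 1 - i)) := by
  have hlt : ∀ i, f i < n := fun i => (hR.mem_iff (f i)).2 ⟨i, rfl⟩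
  have hinv : ∀ i, n - 1 - (n - 1 - f i) = f i := fun i => by have := hlt i; omega
  refine ⟨fun i i' h => hR.inj ?_, fun k => ?_, fun t i i' => ?_, fun t i i' => ?_⟩
  · have h1 := hlt i
    have h2 := hlt i'
    have h : n - 1 - f i = n - 1 - f i' := h
    omega
  · constructor
    · intro hk
      have hk : k < n := hk
      obtain ⟨i, hi⟩ := (hR.mem_iff (n - 1 - k)).1 (Set.mem_Iio.2 (by omega))
      refine ⟨i, ?_⟩
      show n - 1 - f i = k
      omega
    · rintro ⟨i, rfl⟩
      have := hlt i
      exact Set.mem_Iio.2 (by omega)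
  · rw [hR.near_iff, hinv, hinv, neg_sub_neg, abs_sub_comm]
  · rw [hR.eq_iff, hinv, hinv, neg_inj]

/-- The gaps within and next to the groups shed so far are zero or exceed `θ`. -/
lemma Sheds.gap_dichotomy {θ : ℝ} {S : Set ℕ} {X : ℕ → ℕ → ℝ} (hX : IsEvolution θ S X)
    (hθ : 0 ≤ θ) {k t i : ℕ} (h : Sheds θ S X k) (ht : 8 * k + 1 ≤ t) (hi : i < 4 * k) :
    X t i = X t (i + 1) ∨ θ < X t (i + 1) - X t i := by
  have hj : i / 4 < k := by omega
  have hS := (h (i / 4) hj).1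
  rcases (by omega : i = 4 * (i / 4) + 3 ∨ i + 1 ≤ 4 * (i / 4) + 3) with h3 | h3
  · right
    have := h.gap hX hj (t := t) (by omega)
    rwa [show 4 * (i / 4) + 4 = i + 1 by omega, ← h3] at this
  · left
    have e := h.eq_of_lt hX hθ hj (t := t) (by omega)
    have m1 := hX.mono t (4 * (i / 4)) i (by omega) (hX.lower _ _ (by omega) hS)
    have m2 := hX.mono t i (i + 1) (by omega) (hX.lower _ _ (by omega) hS)
    have m3 := hX.mono t (i + 1) (4 * (i / 4) + 3) h3 (hX.lower _ _ (by omega) hS)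
    linarith

section Finite

variable {θ : ℝ} {n : ℕ} {X : ℕ → ℕ → ℝ} {x : ℕ → Fin n → ℝ}

lemma reflect_gap_eq_one (h0 : ∀ i, i + 1 < n → X 0 (i + 1) - X 0 i = 1) :
    ∀ i, i + 1 < n → -X 0 (n - 1 - (i + 1)) - -X 0 (n - 1 - i) = 1 := by
  intro i hi
  have := h0 (n - 1 - (i + 1)) (by omega)
  rw [show n - 1 - (i + 1) + 1 = n - 1 - i by omega] at this
  linarith

lemma sheds_reflect (hX : IsEvolution θ (Set.Iio n) X) (h1 : 61 / 50 ≤ θ) (h2 : θ < 123 / 100)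
    (h0 : ∀ i, i + 1 < n → X 0 (i + 1) - X 0 i = 1) {k : ℕ} (hk : 8 * k ≤ n) :
    Sheds θ (Set.Iio n) (fun t i => -X t (n - 1 - i)) k :=
  sheds_fin hX.reflect h1 h2 (reflect_gap_eq_one h0) hk

/-- The gap between the agents left in the middle and those shed on the right. -/
lemma gap_after (hX : IsEvolution θ (Set.Iio n) X) (h1 : 61 / 50 ≤ θ) (h2 : θ < 123 / 100)
    (h0 : ∀ i, i + 1 < n → X 0 (i + 1) - X 0 i = 1) {j t c : ℕ} (hj : 8 * j ≤ n)
    (ht : 8 * j ≤ t) (hc : c + 1 + 4 * j = n) (hc' : c + 1 < n) : θ < X t (c + 1) - X t c := by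
  have := (sheds_reflect hX h1 h2 h0 hj).gap_before hX.reflect le_rfl ht
    (c := 4 * j - 1) (by omega)
  rw [show n - 1 - (4 * j - 1 + 1) = c by omega, show n - 1 - (4 * j - 1) = c + 1 by omega] at this
  linarith

lemma separated_middle (hX : IsEvolution θ (Set.Iio n) X) (h1 : 61 / 50 ≤ θ) (h2 : θ < 123 / 100)
    (h0 : ∀ i, i + 1 < n → X 0 (i + 1) - X 0 i = 1) {j t : ℕ} (hj : 8 * j < n)
    (ht : 8 * j ≤ t) : Separated θ (Set.Iio n) {i | 4 * j ≤ i ∧ i + 4 * j < n} (X t) where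
  sub i hi := Set.mem_Iio.2 (by have := hi.2; omega)
  nonempty := ⟨4 * j, le_refl (4 * j), by omega⟩
  ord a b c ha hc hab hbc := ⟨ha.1.trans hab, by have := hc.2; omega⟩
  border := by
    intro c hcn hc
    rw [Set.mem_Iio] at hcn
    simp only [Set.mem_ofPred_eq] at hc
    rcases (by omega : c + 1 = 4 * j ∨ c + 1 + 4 * j = n) with h | h
    · exact (sheds_fin hX h1 h2 h0 hj.le).gap_before hX le_rfl ht h
    · exact gap_after hX h1 h2 h0 hj.le ht h hcn

/-- The collapse of the fewer than eight agents left in the middle. -/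
lemma middle_collapse (hX : IsEvolution θ (Set.Iio n) X) (h1 : 61 / 50 ≤ θ) (h2 : θ < 123 / 100)
    (h0 : ∀ i, i + 1 < n → X 0 (i + 1) - X 0 i = 1) {k : ℕ} (hk : 8 * k < n)
    (hk' : n < 8 * k + 8) :
    (∀ i, 4 * k ≤ i → i + 1 + 4 * k < n → X (8 * k) (i + 1) - X (8 * k) i ≤ θ) ∧
    ∀ t, 8 * k + 11 ≤ t → (n ≠ 8 * k + 6 → X t (4 * k) = X t (n - 4 * k - 1)) ∧
      (n = 8 * k + 6 → X t (4 * k) = X t (4 * k + 2) ∧ θ < X t (4 * k + 3) - X t (4 * k + 2) ∧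
        X t (4 * k + 3) = X t (4 * k + 5)) := by
  obtain ⟨hE, hB⟩ := middle_evolution hX h1 h2 h0 hk.le
  obtain ⟨hc, hd, he⟩ := final_collapse hE h1 h2 (by omega) (by omega) hB
  have hθ : 0 ≤ θ := by linarith
  have hmem : ∀ i, i < n → i ∈ Set.Iio n := fun i hi => hi
  refine ⟨fun i hi hi' => ?_, fun t ht => ⟨fun h6 => ?_, fun h6 => ?_⟩⟩
  · have := hc (i - 4 * k) (by omega)
    rwa [add_zero, show 4 * k + (i - 4 * k + 1) = i + 1 by omega,
      show 4 * k + (i - 4 * k) = i by omega] at this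
  · refine hX.eq_of_le hθ ht (hmem _ (by omega)) (hmem _ (by omega)) ?_
    have := hd (by omega)
    rwa [add_zero, show 4 * k + (n - 8 * k - 1) = n - 4 * k - 1 by omega] at this
  · obtain ⟨e1, e2, e3⟩ := he (by omega)
    exact ⟨hX.eq_of_le hθ ht (hmem _ (by omega)) (hmem _ (by omega)) e1,
      hX.gap_of_le ht (hmem _ (by omega)) e2,
      hX.eq_of_le hθ ht (hmem _ (by omega)) (hmem _ (by omega)) e3⟩

theorem periodicFin_of_evolution (hX : IsEvolution θ (Set.Iio n) X)
    (hR : Realizes θ (Set.Iio n) Fin.val x X) (h1 : 61 / 50 ≤ θ) (h2 : θ < 123 / 100)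
    (h0 : ∀ i, i + 1 < n → X 0 (i + 1) - X 0 i = 1) {k : ℕ} (hk : 8 * k ≤ n)
    (hk' : n < 8 * k + 8) : PeriodicFin x k := by
  have hθ : 0 ≤ θ := by linarith
  refine ⟨hk, fun j hj t ht ht' => ?_, fun j hj => ⟨?_, ?_⟩, fun hlt => ?_⟩
  · exact (separated_middle hX h1 h2 h0 (by omega) ht).isComponent hX hR fun c hc hc' =>
      connected_fin hX h1 h2 h0 (by omega) ht ht' hc.1 hc'.2
  · exact (sheds_fin hX h1 h2 h0 hk).detachesAt hX hR hθ hj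
  · have := (sheds_reflect hX h1 h2 h0 hk).detachesAt hX.reflect hR.reflect hθ hj
    have e : {i : Fin n | 4 * j ≤ n - 1 - (i : ℕ) ∧ n - 1 - (i : ℕ) < 4 * (j + 1)} =
        rightGroup n j := by
      ext i
      have := i.2
      simp only [rightGroup, Set.mem_ofPred_eq]
      omega
    rwa [e] at this
  · exact (separated_middle hX h1 h2 h0 hlt le_rfl).isComponent hX hR fun c hc hc' =>
      (middle_collapse hX h1 h2 h0 hlt hk').1 c hc.1 hc'.2

theorem middleCollapsed_of_evolution (hX : IsEvolution θ (Set.Iio n) X)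
    (hR : Realizes θ (Set.Iio n) Fin.val x X) (h1 : 61 / 50 ≤ θ) (h2 : θ < 123 / 100)
    (h0 : ∀ i, i + 1 < n → X 0 (i + 1) - X 0 i = 1) {k t : ℕ} (hk' : n < 8 * k + 8)
    (ht : 8 * k + 11 ≤ t) : MiddleCollapsed (x t) k := by
  have hθ : 0 ≤ θ := by linarith
  refine ⟨fun hlt h6 => ?_, fun h6 => ?_⟩
  · refine (separated_middle hX h1 h2 h0 hlt (by omega)).isCluster hX hR hθ fun c hc l hl hcl => ?_
    have e := ((middle_collapse hX h1 h2 h0 hlt hk').2 t ht).1 h6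
    have hl2 := hl.2
    have m1 := hX.mono t (4 * k) c hc.1 (Set.mem_Iio.2 (by omega))
    have m2 := hX.mono t c l hcl (Set.mem_Iio.2 (by omega))
    have m3 := hX.mono t l (n - 4 * k - 1) (by omega) (Set.mem_Iio.2 (by omega))
    linarith
  · obtain ⟨e1, e2, e3⟩ := ((middle_collapse hX h1 h2 h0 (by omega) hk').2 t ht).2 h6
    have hsep := separated_middle hX h1 h2 h0 (j := k) (t := t) (by omega) (by omega)
    have htriple : ∀ a, (a = 4 * k ∨ a = 4 * k + 3) → X t a = X t (a + 2) →
        IsCluster (x t) {i | a ≤ (i : ℕ) ∧ (i : ℕ) < a + 3} := by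
      intro a ha e
      have hs : Separated θ (Set.Iio n) {i | a ≤ i ∧ i < a + 3} (X t) :=
        ⟨fun i hi => Set.mem_Iio.2 (by have := hi.2; omega), ⟨a, le_refl a, by omega⟩,
          fun b c d hb hd hbc hcd => ⟨hb.1.trans hbc, hcd.trans_lt hd.2⟩, fun c hcn hc => by
            rw [Set.mem_Iio] at hcn
            simp only [Set.mem_ofPred_eq] at hc
            by_cases h3 : c = 4 * k + 2
            · rw [h3]
              exact e2
            · refine hsep.border c hcn ?_
              simp only [Set.mem_ofPred_eq]
              omega⟩
      refine hs.isCluster hX hR hθ fun c hc l hl hcl => ?_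
      have hl2 := hl.2
      have m1 := hX.mono t a c hc.1 (Set.mem_Iio.2 (by omega))
      have m2 := hX.mono t c l hcl (Set.mem_Iio.2 (by omega))
      have m3 := hX.mono t l (a + 2) (by omega) (Set.mem_Iio.2 (by omega))
      linarith
    exact ⟨htriple _ (Or.inl rfl) e1, htriple _ (Or.inr rfl) e3⟩

theorem frozen_of_evolution (hX : IsEvolution θ (Set.Iio n) X)
    (hR : Realizes θ (Set.Iio n) Fin.val x X) (h1 : 61 / 50 ≤ θ) (h2 : θ < 123 / 100)
    (h0 : ∀ i, i + 1 < n → X 0 (i + 1) - X 0 i = 1) {k t : ℕ} (hk : 8 * k ≤ n)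
    (hk' : n < 8 * k + 8) (ht : 8 * k + 11 ≤ t) : Frozen (x t) := by
  have hθ : 0 ≤ θ := by linarith
  refine frozen_of_gaps hR hX.lower (hX.mono t) fun i hi => ?_
  rw [Set.mem_Iio] at hi
  rcases Nat.lt_or_ge i (4 * k) with hl | hl
  · exact (sheds_fin hX h1 h2 h0 hk).gap_dichotomy hX hθ (by omega) hl
  rcases Nat.lt_or_ge (n - 2 - i) (4 * k) with hr | hr
  · have := (sheds_reflect hX h1 h2 h0 hk).gap_dichotomy hX.reflect hθ (t := t) (by omega) hr
    beta_reduce at this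
    rw [show n - 1 - (n - 2 - i) = i + 1 by omega, show n - 1 - (n - 2 - i + 1) = i by omega] at this
    rcases this with h | h
    · left
      linarith
    · right
      linarith
  have hm := (middle_collapse hX h1 h2 h0 (k := k) (by omega) hk').2 t ht
  have mono : ∀ a b, a ≤ b → b < n → X t a ≤ X t b := hX.mono t
  by_cases h6 : n = 8 * k + 6
  · obtain ⟨e1, e2, e3⟩ := hm.2 h6
    rcases (by omega : i + 1 ≤ 4 * k + 2 ∨ i = 4 * k + 2 ∨ 4 * k + 3 ≤ i) with h | rfl | h
    · left
      linarith [mono (4 * k) i hl (by omega), mono i (i + 1) (by omega) hi,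
        mono (i + 1) (4 * k + 2) h (by omega)]
    · exact Or.inr e2
    · left
      linarith [mono (4 * k + 3) i h (by omega), mono i (i + 1) (by omega) hi,
        mono (i + 1) (4 * k + 5) (by omega) (by omega)]
  · left
    linarith [hm.1 h6, mono (4 * k) i hl (by omega), mono i (i + 1) (by omega) hi,
      mono (i + 1) (n - 4 * k - 1) (by omega) (by omega)]

/-- Before the last group has been shed, the configuration is not frozen: in a frozen
configuration every gap keeps being zero or larger than `θ`. -/
theorem le_of_frozen (hX : IsEvolution θ (Set.Iio n) X)
    (hR : Realizes θ (Set.Iio n) Fin.val x X) (h1 : 61 / 50 ≤ θ) (h2 : θ < 123 / 100)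
    (h0 : ∀ i, i + 1 < n → X 0 (i + 1) - X 0 i = 1) {k t : ℕ} (hk : 8 * k ≤ n)
    (hfr : Frozen (x t)) : 8 * k ≤ t := by
  by_contra hlt
  have hθ : 0 ≤ θ := by linarith
  obtain ⟨hS, hF⟩ := sheds_fin hX h1 h2 h0 hk (k - 1) (by omega)
  rw [show 8 * (k - 1 + 1) = 8 * k by omega] at hF
  have hS : 4 * (k - 1) + 4 < n := hS
  have g1 : X (8 * k) (4 * (k - 1) + 2) < X (8 * k) (4 * (k - 1) + 3) := hF.spread
  have g2 : X (8 * k) (4 * (k - 1) + 3) - X (8 * k) (4 * (k - 1) + 0) ≤ θ := hF.span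
  have g3 := hX.mono (8 * k) (4 * (k - 1) + 0) (4 * (k - 1) + 2) (by omega)
    (Set.mem_Iio.2 (by omega))
  have m2 : 4 * (k - 1) + 2 ∈ Set.Iio n := Set.mem_Iio.2 (by omega)
  have m3 : 4 * (k - 1) + 2 + 1 ∈ Set.Iio n := Set.mem_Iio.2 (by omega)
  by_cases he : X t (4 * (k - 1) + 2) = X t (4 * (k - 1) + 2 + 1)
  · have := hX.eq_of_le hθ (show t ≤ 8 * k by omega) m2 m3 he
    rw [show 4 * (k - 1) + 2 + 1 = 4 * (k - 1) + 3 by omega] at this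
    linarith
  · obtain ⟨i, hi⟩ := (hR.mem_iff _).1 m2
    obtain ⟨i', hi'⟩ := (hR.mem_iff _).1 m3
    rw [← hi', ← hi, ← hR.eq_iff] at he
    have h3 := hfr i i' he
    rw [← not_le, hR.near_iff, not_le, hi, hi', abs_sub_comm,
      abs_of_nonneg (sub_nonneg.2 (hX.mono t _ _ (by omega) m3))] at h3
    have := hX.gap_of_le (show t ≤ 8 * k by omega) m3 h3
    rw [show 4 * (k - 1) + 2 + 1 = 4 * (k - 1) + 3 by omega] at this
    linarith

end Finite
end HK

theorem theorem3 :
    ∃ a b : ℝ, a < b ∧ Set.Ioo a b ⊆ Set.Ioc (4 / 5 : ℝ) (31104 / 36979) ∧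
      ∀ d ∈ Set.Ioo a b,
        HK.PeriodicInf (HK.evolve (HK.equalInf d)) ∧
        ∃ C C' K : ℕ, 0 < C ∧ 0 < C' ∧ ∀ n : ℕ,
          (∃ k : ℕ, n ≤ 8 * k + C ∧
            HK.PeriodicFin (HK.evolve (HK.equalFin n d)) k ∧
            ∀ t, 8 * k + C' ≤ t →
              HK.MiddleCollapsed (HK.evolve (HK.equalFin n d) t) k ∧
              HK.Frozen (HK.evolve (HK.equalFin n d) t)) ∧
          ∃ T : ℕ, IsLeast {t | HK.Frozen (HK.evolve (HK.equalFin n d) t)} T ∧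
            |(T : ℤ) - (n : ℤ)| ≤ (K : ℤ) := by
  -- On this interval the scaled confidence radius `1 / d` lies in `(61 / 50, 123 / 100)`.
  refine ⟨100 / 123, 50 / 61, by norm_num, fun d hd => ⟨?_, ?_⟩, fun d hd => ?_⟩
  · linarith [hd.1]
  · linarith [hd.2]
  have hd0 : 0 < d := by linarith [hd.1]
  have h1 : 61 / 50 ≤ 1 / d := by
    rw [le_div_iff₀ hd0]
    linarith [hd.2]
  have h2 : 1 / d < 123 / 100 := by
    rw [div_lt_iff₀ hd0]
    linarith [hd.1]
  -- The number `n / 8` of periods leaves at most seven agents, which freeze within eleven steps.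
  refine ⟨HK.periodicInf_equalInf hd0 h1 h2, 7, 11, 11, by norm_num, by norm_num, fun n => ?_⟩
  have hX := HK.isEvolution_equalFin hd0 n
  have hR := HK.realizes_scaled hd0 Fin.val_injective HK.mem_Iio_iff_exists_fin (HK.equalFin n d)
  have h0 : ∀ i, i + 1 < n → HK.scaled d Fin.val (HK.equalFin n d) 0 (i + 1) -
      HK.scaled d Fin.val (HK.equalFin n d) 0 i = 1 := by
    intro i hi
    rw [HK.scaled_equalFin hd0 hi, HK.scaled_equalFin hd0 (by omega)]
    push_cast
    ring
  have hk : 8 * (n / 8) ≤ n := by omega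
  have hk' : n < 8 * (n / 8) + 8 := by omega
  have hfr : ∀ t, 8 * (n / 8) + 11 ≤ t → HK.Frozen (HK.evolve (HK.equalFin n d) t) :=
    fun t ht => HK.frozen_of_evolution hX hR h1 h2 h0 hk hk' ht
  refine ⟨⟨n / 8, by omega, HK.periodicFin_of_evolution hX hR h1 h2 h0 hk hk', fun t ht =>
    ⟨HK.middleCollapsed_of_evolution hX hR h1 h2 h0 hk' ht, hfr t ht⟩⟩, ?_⟩
  classical
  have hex : ∃ t, HK.Frozen (HK.evolve (HK.equalFin n d) t) := ⟨_, hfr _ le_rfl⟩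
  refine ⟨Nat.find hex, ⟨Nat.find_spec hex, fun t ht => Nat.find_min' hex ht⟩, ?_⟩
  have hle := Nat.find_min' hex (hfr _ le_rfl)
  have hge := HK.le_of_frozen hX hR h1 h2 h0 hk (Nat.find_spec hex)
  rw [abs_le]
  constructor <;> push_cast <;> omega
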